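/- Let $1\le s\le k/100$ and $\ell\ge 1$ be integers, and let $\triangle_{k,s}$ be the set of probability distributions $p$ on $[k]=\{1,\dots,k\}$ with at most $s$ nonzero entries. Each of $n$ users observes one independent sample $X_i\sim p$ and sends the server an $\ell$-bit message $Y_i=W_i(X_i)$, where $W_i:[k]\to\{0,1\}^\ell$ is a randomized map (channel); all messages are sent simultaneously, and the randomness of the channels is independent across users. The protocol is public-coin: the channels $W_1,\dots,W_n$ may depend on a public random variable $U$, independent of the samples, which is also seen by the server; the server outputs an estimate $\hat p=\hat p(U,Y_1,\dots,Y_n)$, a distribution on $[k]$. Let $\mathrm{SC}(\alpha,\triangle_{k,s},\mathcal W_\ell,d_{\rm TV})$ be the least $n$ for which some such protocol satisfies $\Pr[d_{\rm TV}(p,\hat p)\le\alpha]\ge 0.9$ for every $p\in\triangle_{k,s}$, where $d_{\rm TV}(p,q)=\frac12\|p-q\|_1$. There are absolute constants $C,c>0$ such that, for all such $k,s,\ell$ and every $\alpha\in(0,1)$, \[ \mathrm{SC}(\alpha,\triangle_{k,s},\mathcal W_\ell,d_{\rm TV})\le C\,\frac{s^2\max\{\log(k/s),1\}}{\alpha^2\min\{2^\ell,s\}},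 \] and, for all such $k,s,\ell$ with $s\ge 2$ and every $\alpha\in(0,1/8]$, \[ \mathrm{SC}(\alpha,\triangle_{k,s},\mathcal W_\ell,d_{\rm TV})\ge c\,\max\left\{\frac{s^2}{\alpha^2\min\{2^\ell,s\}},\ \frac{s^2\max\{\log(k/s),1\}}{\alpha\,2^\ell}\right\}. \] -/

import Mathlib

noncomputable section

open MeasureTheory

/-- Total variation distance `(1/2) ‖p - q‖₁` of two probability vectors on `[k]`. -/
def tvDist {k : ℕ} (p q : stdSimplex ℝ (Fin k)) : ℝ :=
  (1 / 2) * ∑ x, |p.1 x - q.1 x|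

/-- `△_{k,s}`: the probability vectors on `[k]` with at most `s` nonzero entries. -/
def sparseDistributions (k s : ℕ) : Set (stdSimplex ℝ (Fin k)) :=
  {p | {x | p.1 x ≠ 0}.ncard ≤ s}

/-- A channel `W : [k] → Y`: a randomized map; `(W x).1 y` is the probability `W(y ∣ x)`. -/
abbrev Channel (k : ℕ) (Y : Type) [Fintype Y] : Type :=
  Fin k → stdSimplex ℝ Y

/-- `𝒲_ℓ`: all channels from `[k]` whose output is an `ℓ`-bit string. -/
def bitChannels (k ℓ : ℕ) : Set (Channel k (Fin ℓ → Bool)) :=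
  Set.univ

/-- The law of the message `Y = W(X)` when `X ∼ p`. -/
def Channel.output {k : ℕ} {Y : Type} [Fintype Y] (W : Channel k Y)
    (p : stdSimplex ℝ (Fin k)) (y : Y) : ℝ :=
  ∑ x, p.1 x * (W x).1 y

/-- A public-coin simultaneous-message-passing protocol for estimating a distribution on `[k]`
with `n` users and channels from `𝒲`. A public random variable, independent of the samples, is
drawn from the probability space `(Ω, μ)`. When its value is `u`, user `i` passes its sample
through the channel `channel u i`, and the server, which sees `u` and the `n` messages `y`,
outputs `estimator u y`. Private-coin protocols are those in which nothing depends on `u`. -/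
structure PublicCoinProtocol (k n : ℕ) (Y : Type) [Fintype Y] (𝒲 : Set (Channel k Y)) where
  Ω : Type
  [measurableSpace : MeasurableSpace Ω]
  μ : Measure Ω
  [isProbabilityMeasure : IsProbabilityMeasure μ]
  channel : Ω → Fin n → Channel k Y
  channel_mem : ∀ u i, channel u i ∈ 𝒲
  measurable_channel : ∀ i x y, Measurable fun u => (channel u i x).1 y
  estimator : Ω → (Fin n → Y) → stdSimplex ℝ (Fin k)
  measurable_estimator : ∀ y x, Measurable fun u => (estimator u y).1 x

attribute [instance] PublicCoinProtocol.measurableSpace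
  PublicCoinProtocol.isProbabilityMeasure

open Classical in
/-- The probability, over the public randomness, `n` independent samples from `p` and the
randomness of the channels, that the estimate is within distance `α` of `p`. Given the public
randomness `u`, the messages are independent, so that the message vector `y` has probability
`∏ i, (channel u i).output p (y i)`. -/
def PublicCoinProtocol.successProb {k n : ℕ} {Y : Type} [Fintype Y] {𝒲 : Set (Channel k Y)}
    (P : PublicCoinProtocol k n Y 𝒲)
    (d : stdSimplex ℝ (Fin k) → stdSimplex ℝ (Fin k) → ℝ) (α : ℝ)
    (p : stdSimplex ℝ (Fin k)) : ℝ :=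
  ∫ u, ∑ y : Fin n → Y,
    (∏ i, (P.channel u i).output p (y i)) * (if d p (P.estimator u y) ≤ α then 1 else 0) ∂P.μ

/-- `SC(α, Δ, 𝒲, d)`: the least `n` for which some public-coin protocol with `n` users and
channels from `𝒲` estimates every `p ∈ Δ` to within `α` with probability at least `0.9`;
it is `⊤` if there is no such `n`. -/
def sampleComplexity {k : ℕ} {Y : Type} [Fintype Y] (α : ℝ) (Δ : Set (stdSimplex ℝ (Fin k)))
    (𝒲 : Set (Channel k Y)) (d : stdSimplex ℝ (Fin k) → stdSimplex ℝ (Fin k) → ℝ) : ℕ∞ :=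
  ⨅ (n : ℕ) (_ : ∃ P : PublicCoinProtocol k n Y 𝒲, ∀ p ∈ Δ, (9 / 10 : ℝ) ≤ P.successProb d α p),
    (n : ℕ∞)

end

noncomputable section

open MeasureTheory

/-! Upper bound: public coins give each user an independent uniform hash `h : [k] → [M]`, and the
message is the hash of the sample. For each `x`, the event that the message equals `h x` has
probability `1/M + (1 - 1/M) p(x)`, so linear statistics of the collisions reveal linear functionals
of `p`. The server returns any sparse distribution compatible with all statistics given by sign
vectors of support at most `2s`; testing on the sign of `p - q` shows that two compatible
distributions are close (`Consistent.tvDist_le`). An exponential moment bound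
(`sum_exp_sum_collisions_le`) and a union bound over about `exp(2s log(k/s) + 2s)` sign vectors
(`card_sparseSigns_le`) give the number of users.

Lower bound: a Fano argument with χ²-divergence (`log_inv_le_of_successProb`), applied to families
indexed by `[b]^m` whose total variation distance is proportional to Hamming distance
(`mul_log_le_of_successProb`). Two families are used. Sign perturbations of the uniform law on `s/2`
pairs have `b = 2`; each message carries information at most of order `α² min(2^ℓ/s, 1)`. A point
mass mixed with weight `8α` of the uniform law on the graph of `f : [s-1] → [k/s]` gains the factor
`log(k/s)`; there a message carries order `α 2^ℓ/s`, only linear in `α` because the χ² is relative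
to a background of mass `8α`. -/

/-! ### Product measures and a χ² version of Fano's inequality -/

theorem sum_prod_mul_apply {n : ℕ} {Y : Type*} [Fintype Y] (q : Fin n → Y → ℝ)
    (hq : ∀ i, ∑ y, q i y = 1) (i : Fin n) (g : Y → ℝ) :
    ∑ y : Fin n → Y, (∏ j, q j (y j)) * g (y i) = ∑ b, q i b * g b := by
  classical
  have h1 : ∀ y : Fin n → Y, (∏ j, q j (y j)) * g (y i) =
      ∏ j, (q j (y j) * if j = i then g (y j) else 1) := by
    intro y
    rw [Finset.prod_mul_distrib, Finset.prod_ite_eq' Finset.univ i (fun j => g (y j))]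
    simp
  have h2 := Finset.prod_univ_sum (fun _ : Fin n => (Finset.univ : Finset Y))
    (fun j b => q j b * if j = i then g b else 1)
  rw [Fintype.piFinset_univ] at h2
  simp_rw [h1]
  rw [← h2, Finset.prod_eq_single i]
  · simp
  · intro j _ hj
    simp [hj, hq]
  · simp

theorem sum_prod_eq_prod_sum {n : ℕ} {Y : Type*} [Fintype Y] (q : Fin n → Y → ℝ) :
    ∑ y : Fin n → Y, ∏ j, q j (y j) = ∏ j, ∑ b, q j b := by
  classical
  rw [Finset.prod_univ_sum, Fintype.piFinset_univ]

/-- Change of measure for product distributions: `E_P f ≤ ∑ χ²(q i ‖ r i) - 1 + E_Q e^f`. -/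
theorem change_of_measure {n : ℕ} {Y : Type*} [Fintype Y] (q r : Fin n → Y → ℝ)
    (hq : ∀ i y, 0 ≤ q i y) (hq1 : ∀ i, ∑ y, q i y = 1) (hr : ∀ i y, 0 ≤ r i y)
    (hqr : ∀ i y, r i y = 0 → q i y = 0) (f : (Fin n → Y) → ℝ) :
    ∑ y : Fin n → Y, (∏ i, q i (y i)) * f y ≤
      ∑ i, ∑ y, q i y * (q i y / r i y - 1) - 1 +
        ∑ y : Fin n → Y, (∏ i, r i (y i)) * Real.exp (f y) := by
  have hpt : ∀ y : Fin n → Y, (∏ i, q i (y i)) * f y ≤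
      ∑ i, (∏ j, q j (y j)) * (q i (y i) / r i (y i) - 1) - (∏ i, q i (y i)) +
        (∏ i, r i (y i)) * Real.exp (f y) := by
    intro y
    set P := ∏ i, q i (y i) with hP
    set S := ∑ i, (q i (y i) / r i (y i) - 1) with hS
    have hP0 : 0 ≤ P := Finset.prod_nonneg fun i _ => hq i _
    -- Apply `x ≤ exp (x - 1)` to each likelihood ratio: the product of the ratios is at most `exp
    -- S`, and the `P`-mean of `S` is the sum of the χ²-divergences.
    have hPQ : P ≤ (∏ i, r i (y i)) * Real.exp S := by
      rw [hS, Real.exp_sum, ← Finset.prod_mul_distrib]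
      refine Finset.prod_le_prod (fun i _ => hq i _) fun i _ => ?_
      rcases (hr i (y i)).eq_or_lt with h0 | h0
      · rw [hqr i _ h0.symm, ← h0]; simp
      · have h2 := Real.add_one_le_exp (q i (y i) / r i (y i) - 1)
        calc q i (y i) = r i (y i) * (q i (y i) / r i (y i) - 1 + 1) := by field_simp; ring
          _ ≤ _ := mul_le_mul_of_nonneg_left h2 h0.le
    have h3 : P * (f y - S + 1) ≤ (∏ i, r i (y i)) * Real.exp (f y) := by
      calc P * (f y - S + 1) ≤ P * Real.exp (f y - S) :=
            mul_le_mul_of_nonneg_left (Real.add_one_le_exp _) hP0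
        _ ≤ (∏ i, r i (y i)) * Real.exp S * Real.exp (f y - S) :=
            mul_le_mul_of_nonneg_right hPQ (Real.exp_pos _).le
        _ = _ := by rw [mul_assoc, ← Real.exp_add]; ring_nf
    rw [← Finset.mul_sum]
    linarith
  refine (Finset.sum_le_sum fun y _ => hpt y).trans (le_of_eq ?_)
  rw [Finset.sum_add_distrib, Finset.sum_sub_distrib, Finset.sum_comm, sum_prod_eq_prod_sum]
  congr 2
  · refine Finset.sum_congr rfl fun i _ => ?_
    exact sum_prod_mul_apply q hq1 i fun b => q i b / r i b - 1
  · simp [hq1]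

open Classical in
/-- Fano-type bound on the average probability of a family of events, each observation `y` of which
belongs to at most a fraction `δ` of the events. -/
theorem avg_prob_mul_log_le {n : ℕ} {Y Θ : Type*} [Fintype Y] [Fintype Θ] [Nonempty Θ]
    (q : Θ → Fin n → Y → ℝ) (r : Fin n → Y → ℝ)
    (hq : ∀ θ i y, 0 ≤ q θ i y) (hq1 : ∀ θ i, ∑ y, q θ i y = 1) (hr : ∀ i y, 0 ≤ r i y)
    (hr1 : ∀ i, ∑ y, r i y = 1) (hqr : ∀ θ i y, r i y = 0 → q θ i y = 0)
    (A : Θ → (Fin n → Y) → Prop) {δ K : ℝ} (hδ : 0 < δ)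
    (hA : ∀ y, ((Finset.univ.filter fun θ => A θ y).card : ℝ) ≤ δ * Fintype.card Θ)
    (hK : ∀ i, ∑ θ, ∑ y, q θ i y * (q θ i y / r i y - 1) ≤ K * Fintype.card Θ) :
    (∑ θ, ∑ y : Fin n → Y, (∏ i, q θ i (y i)) * (if A θ y then 1 else 0)) * Real.log (9 / δ) ≤
      (n * K + Real.log 10) * Fintype.card Θ := by
  set N : ℝ := (Fintype.card Θ : ℝ) with hN
  -- With this choice `exp f` is `9/(10δ)` on the event and `1/10` off it, so its average over `θ`
  -- is at most `9/10 + 1/10 = 1` and cancels the `-1` in `change_of_measure`.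
  set f : Θ → (Fin n → Y) → ℝ := fun θ y =>
    (if A θ y then 1 else 0) * Real.log (9 / δ) - Real.log 10 with hf
  have hmain := Finset.sum_le_sum fun θ (_ : θ ∈ Finset.univ) =>
    change_of_measure (q θ) r (hq θ) (hq1 θ) hr (hqr θ) (f θ)
  have hexp : ∀ θ y, Real.exp (f θ y) ≤ (9 / (10 * δ)) * (if A θ y then 1 else 0) + 1 / 10 := by
    intro θ y
    have : Real.exp (Real.log (9 / δ) - Real.log 10) = 9 / (10 * δ) := by
      rw [Real.exp_sub, Real.exp_log (by positivity), Real.exp_log (by norm_num)]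
      field_simp
    by_cases h : A θ y
    · simp only [hf, h, if_true, one_mul, this, mul_one]; linarith
    · simp only [hf, h, if_false, zero_mul, zero_sub, Real.exp_neg,
        Real.exp_log (show (0 : ℝ) < 10 by norm_num)]; norm_num
  have hQ : ∑ θ, ∑ y : Fin n → Y, (∏ i, r i (y i)) * Real.exp (f θ y) ≤ N := by
    rw [Finset.sum_comm]
    calc _ ≤ ∑ y : Fin n → Y, (∏ i, r i (y i)) * N := by
          refine Finset.sum_le_sum fun y _ => ?_
          rw [← Finset.mul_sum]
          refine mul_le_mul_of_nonneg_left ?_ (Finset.prod_nonneg fun i _ => hr i _)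
          refine (Finset.sum_le_sum fun θ _ => hexp θ y).trans ?_
          rw [Finset.sum_add_distrib, ← Finset.mul_sum]
          simp only [Finset.sum_boole, Finset.sum_const, Finset.card_univ, nsmul_eq_mul]
          have := mul_le_mul_of_nonneg_left (hA y) (show 0 ≤ 9 / (10 * δ) by positivity)
          have h9 : 9 / (10 * δ) * (δ * N) = 9 / 10 * N := by
            field_simp
          linarith
      _ = N := by rw [← Finset.sum_mul, sum_prod_eq_prod_sum]; simp [hr1]
  have hP : ∀ θ, ∑ y : Fin n → Y, (∏ i, q θ i (y i)) * f θ y =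
      (∑ y : Fin n → Y, (∏ i, q θ i (y i)) * (if A θ y then 1 else 0)) * Real.log (9 / δ)
        - Real.log 10 := by
    intro θ
    simp only [hf, mul_sub, Finset.sum_sub_distrib]
    rw [← Finset.sum_mul Finset.univ _ (Real.log 10), sum_prod_eq_prod_sum, Finset.sum_mul]
    simp [hq1]
  have hKs : ∑ θ, ∑ i, ∑ y, q θ i y * (q θ i y / r i y - 1) ≤ n * K * N := by
    rw [Finset.sum_comm]
    refine (Finset.sum_le_sum fun i _ => hK i).trans (le_of_eq ?_)
    simp; ring
  simp only [hP, Finset.sum_sub_distrib, Finset.sum_add_distrib, ← Finset.sum_mul] at hmain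
  simp only [Finset.sum_const, Finset.card_univ, nsmul_eq_mul, mul_one] at hmain
  rw [add_mul]
  linarith

/-! ### Second moments and Hamming balls in `[b]^m` -/

/-- Variances of independent centred variables add: the coordinates of a uniform `f` are
independent, so the cross terms vanish. Used to average the χ²-divergence over the family. -/
theorem sum_sq_sum_apply {b : ℕ} : ∀ {m : ℕ} (X : Fin m → Fin b → ℝ),
    (∀ j, ∑ c, X j c = 0) →
    b * ∑ f : Fin m → Fin b, (∑ j, X j (f j)) ^ 2 = (b : ℝ) ^ m * ∑ j, ∑ c, X j c ^ 2
  | 0, X, _ => by simp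
  | m + 1, X, hX => by
    have ih := sum_sq_sum_apply (fun j => X j.succ) fun j => hX j.succ
    rw [← (Fin.consEquiv fun _ : Fin (m + 1) => Fin b).sum_comp, Fintype.sum_prod_type,
      Finset.sum_comm]
    have h : ∀ g : Fin m → Fin b, ∑ c : Fin b,
        (∑ j, X j ((Fin.consEquiv fun _ : Fin (m + 1) => Fin b) (c, g) j)) ^ 2 =
        ∑ c, X 0 c ^ 2 + b * (∑ j : Fin m, X j.succ (g j)) ^ 2 := by
      intro g
      simp only [Fin.consEquiv, Equiv.coe_fn_mk, Fin.sum_univ_succ, Fin.cons_zero, Fin.cons_succ,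
        add_sq, Finset.sum_add_distrib, ← Finset.sum_mul, ← Finset.mul_sum, hX]
      simp
    rw [Finset.sum_congr rfl fun g _ => h g, Finset.sum_add_distrib, ← Finset.mul_sum, ih,
      Fin.sum_univ_succ]
    simp
    ring

/-- The Hamming balls of radius `m / 4` in `[b]^m` are exponentially small. -/
theorem card_hammingBall_le {b m : ℕ} (hb : 2 ≤ b) (f₀ : Fin m → Fin b) :
    ((Finset.univ.filter fun f => 4 * hammingDist f f₀ ≤ m).card : ℝ) ≤
      Real.exp (-(3 / 20 * m * Real.log b)) * (b : ℝ) ^ m := by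
  have hb0 : (0 : ℝ) < b := by positivity
  have hb2 : (2 : ℝ) ≤ b := by exact_mod_cast hb
  have hlog : 0 < Real.log b := Real.log_pos (by linarith)
  -- Chernoff bound with weight `b^(-d)`, where `d` is the Hamming distance to `f₀`; the weights sum
  -- to `(1 + (b - 1)/b)^m = (2 - 1/b)^m`.
  have hpt : ∀ f : Fin m → Fin b, (if 4 * hammingDist f f₀ ≤ m then (1 : ℝ) else 0) ≤
      Real.exp (m / 4 * Real.log b) * ∏ j, (if f j = f₀ j then 1 else (b : ℝ)⁻¹) := by
    intro f
    have hprod : ∏ j, (if f j = f₀ j then 1 else (b : ℝ)⁻¹) =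
        Real.exp (-(hammingDist f f₀ * Real.log b)) := by
      rw [Finset.prod_ite, Finset.prod_const_one, one_mul, Finset.prod_const, hammingDist,
        Real.exp_neg, mul_comm, Real.exp_mul, Real.exp_log hb0, Real.rpow_natCast, inv_pow]
    rw [hprod, ← Real.exp_add]
    split_ifs with h
    · apply Real.one_le_exp
      have : (4 * hammingDist f f₀ : ℝ) ≤ m := by exact_mod_cast h
      nlinarith
    · positivity
  have hcount : ((Finset.univ.filter fun f => 4 * hammingDist f f₀ ≤ m).card : ℝ) ≤
      Real.exp (m / 4 * Real.log b) * (2 - (b : ℝ)⁻¹) ^ m := by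
    rw [← Finset.sum_boole]
    refine (Finset.sum_le_sum fun f _ => hpt f).trans (le_of_eq ?_)
    rw [← Finset.mul_sum,
      sum_prod_eq_prod_sum fun j c => if c = f₀ j then (1 : ℝ) else (b : ℝ)⁻¹]
    congr 1
    rw [Finset.prod_congr rfl (g := fun _ => 2 - (b : ℝ)⁻¹)]
    · simp
    · intro j _
      rw [Finset.sum_ite, Finset.filter_ne', Finset.filter_eq']
      simp [Finset.card_erase_of_mem, Nat.cast_sub (show 1 ≤ b by omega)]
      field_simp
      ring
  -- The exponent `3/5` leaves `1/4 + 3/5 = 1 - 3/20`. In fifth powers, `b = 2, 3` are checked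
  -- numerically and `b ≥ 4` follows from `2^5 ≤ 4^3`.
  have hbase : 2 - (b : ℝ)⁻¹ ≤ Real.exp (3 / 5 * Real.log b) := by
    have hinv : (b : ℝ)⁻¹ ≤ 1 := inv_le_one_of_one_le₀ (by linarith)
    have h5 : (2 - (b : ℝ)⁻¹) ^ 5 ≤ (b : ℝ) ^ 3 := by
      rcases Nat.lt_or_ge b 4 with h4 | h4
      · interval_cases b <;> norm_num
      · have h4' : (4 : ℝ) ≤ b := by exact_mod_cast h4
        calc (2 - (b : ℝ)⁻¹) ^ 5 ≤ 2 ^ 5 :=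
              pow_le_pow_left₀ (by linarith) (by linarith [inv_nonneg.2 hb0.le]) 5
          _ ≤ (4 : ℝ) ^ 3 := by norm_num
          _ ≤ _ := pow_le_pow_left₀ (by norm_num) h4' 3
    have he : Real.exp (3 / 5 * Real.log b) ^ 5 = (b : ℝ) ^ 3 := by
      rw [← Real.exp_nat_mul, show ((5 : ℕ) : ℝ) * (3 / 5 * Real.log b) = (3 : ℕ) * Real.log b by
        push_cast; ring, Real.exp_nat_mul, Real.exp_log hb0]
    exact le_of_pow_le_pow_left₀ (by norm_num) (Real.exp_pos _).le (he ▸ h5)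
  refine hcount.trans ?_
  have hinv : (b : ℝ)⁻¹ ≤ 1 := inv_le_one_of_one_le₀ (by linarith)
  calc _ ≤ Real.exp (m / 4 * Real.log b) * Real.exp (3 / 5 * Real.log b) ^ m := by
        gcongr
        linarith
    _ = _ := by
      rw [← Real.exp_nat_mul, ← Real.exp_add, ← Real.exp_log (pow_pos hb0 m), ← Real.exp_add,
        Real.log_pow]
      ring_nf

/-- Adding `1` to every coordinate moves a point by distance `m`, hence carries the ball injectively
into its complement. This covers the case where the exponential bound exceeds `1/2`. -/
theorem two_mul_card_hammingBall_le {b m : ℕ} (hb : 2 ≤ b) (hm : 1 ≤ m) (f₀ : Fin m → Fin b) :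
    2 * (Finset.univ.filter fun f => 4 * hammingDist f f₀ ≤ m).card ≤ b ^ m := by
  have : NeZero b := ⟨by omega⟩
  have : Fact (1 < b) := ⟨hb⟩
  set A := Finset.univ.filter fun f => 4 * hammingDist f f₀ ≤ m
  have h1 : A.card ≤ Aᶜ.card := by
    refine Finset.card_le_card_of_injOn (fun f j => f j + 1) ?_ ?_
    · intro f hf
      simp only [A, Finset.coe_filter, Finset.mem_univ, true_and, Set.mem_ofPred_eq,
        Finset.coe_compl, Set.mem_compl_iff] at hf ⊢
      intro hf'
      have h2 : m ≤ hammingDist f (fun j => f j + 1) := by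
        rw [hammingDist, Finset.filter_true_of_mem]
        · simp
        · intro j _ h
          have h3 : (1 : Fin b) = 0 := by simpa using h.symm
          have := congrArg Fin.val h3
          simp [Nat.mod_eq_of_lt hb] at this
      have h3 := hammingDist_triangle f f₀ (fun j => f j + 1)
      rw [hammingDist_comm f₀] at h3
      omega
    · intro f _ g _ h
      funext j
      simpa using congrFun h j
  have h2 := Finset.card_add_card_compl A
  simp only [Fintype.card_pi, Fintype.card_fin, Finset.prod_const, Finset.card_univ] at h2
  omega

/-! ### From success probability to an information bound -/

theorem Channel.output_nonneg {k : ℕ} {Y : Type} [Fintype Y] (W : Channel k Y)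
    (p : stdSimplex ℝ (Fin k)) (y : Y) : 0 ≤ W.output p y :=
  Finset.sum_nonneg fun x _ => mul_nonneg (p.2.1 x) ((W x).2.1 y)

theorem Channel.sum_output {k : ℕ} {Y : Type} [Fintype Y] (W : Channel k Y)
    (p : stdSimplex ℝ (Fin k)) : ∑ y, W.output p y = 1 := by
  simp only [Channel.output]
  rw [Finset.sum_comm]
  simp only [← Finset.mul_sum, (W _).2.2, mul_one, p.2.2]

theorem Channel.output_eq_zero {k : ℕ} {Y : Type} [Fintype Y] (W : Channel k Y)
    {p q : stdSimplex ℝ (Fin k)} (h : ∀ x, q.1 x = 0 → p.1 x = 0) {y : Y}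
    (hy : W.output q y = 0) : W.output p y = 0 := by
  have h0 := (Finset.sum_eq_zero_iff_of_nonneg
    fun x _ => mul_nonneg (q.2.1 x) ((W x).2.1 y)).1 hy
  refine Finset.sum_eq_zero fun x hx => ?_
  rcases mul_eq_zero.1 (h0 x hx) with h1 | h1
  · rw [h x h1, zero_mul]
  · rw [h1, mul_zero]

/-- If a protocol succeeds on each `p θ`, no ball of radius `α` contains more than a fraction `δ` of
the `p θ`, and each message carries `χ²`-information at most `K`, then `n K ≳ log (1 / δ)`. -/
theorem log_inv_le_of_successProb {k n : ℕ} {Y : Type} [Fintype Y] {𝒲 : Set (Channel k Y)}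
    (P : PublicCoinProtocol k n Y 𝒲) {Θ : Type*} [Fintype Θ] [Nonempty Θ]
    (p : Θ → stdSimplex ℝ (Fin k)) {α δ K : ℝ}
    (hP : ∀ θ, (9 / 10 : ℝ) ≤ P.successProb tvDist α (p θ)) (hδ : 0 < δ) (hδ2 : δ ≤ 1 / 2)
    (hball : ∀ q, ((Finset.univ.filter fun θ => tvDist (p θ) q ≤ α).card : ℝ) ≤
      δ * Fintype.card Θ)
    (c : stdSimplex ℝ (Fin k)) (hc : ∀ θ x, c.1 x = 0 → (p θ).1 x = 0)
    (hK : ∀ W : Channel k Y, ∑ θ, ∑ y, W.output (p θ) y *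
      (W.output (p θ) y / W.output c y - 1) ≤ K * Fintype.card Θ) :
    2 / 5 * Real.log (1 / δ) ≤ n * K := by
  classical
  set N : ℝ := (Fintype.card Θ : ℝ) with hN
  have hN0 : 0 < N := by simp [hN, Fintype.card_pos]
  set S : Θ → P.Ω → ℝ := fun θ u => ∑ y : Fin n → Y,
    (∏ i, (P.channel u i).output (p θ) (y i)) *
      (if tvDist (p θ) (P.estimator u y) ≤ α then 1 else 0) with hS
  have hSP : ∀ θ, P.successProb tvDist α (p θ) = ∫ u, S θ u ∂P.μ := by
    intro θ
    simp only [PublicCoinProtocol.successProb, hS]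
  -- The integral of a non-integrable function is `0` by convention, which a success probability of
  -- at least `9/10` excludes.
  have hint : ∀ θ, Integrable (S θ) P.μ := by
    intro θ
    by_contra h
    have h1 := hP θ
    rw [hSP, integral_undef h] at h1
    norm_num at h1
  have hlog9 : 0 < Real.log (9 / δ) := Real.log_pos (by rw [lt_div_iff₀ hδ]; linarith)
  have hu : ∀ u, (∑ θ, S θ u) * Real.log (9 / δ) ≤ (n * K + Real.log 10) * N := by
    intro u
    have := avg_prob_mul_log_le (fun θ i => (P.channel u i).output (p θ))
      (fun i => (P.channel u i).output c) (fun θ i y => Channel.output_nonneg _ _ _)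
      (fun θ i => Channel.sum_output _ _) (fun i y => Channel.output_nonneg _ _ _)
      (fun i => Channel.sum_output _ _) (fun θ i y h => Channel.output_eq_zero _ (hc θ) h)
      (fun θ y => tvDist (p θ) (P.estimator u y) ≤ α) hδ
      (fun y => by convert hball (P.estimator u y)) (fun i => hK (P.channel u i))
    simp only [hS]
    convert this
  have hsum : N * (9 / 10) * Real.log (9 / δ) ≤ (n * K + Real.log 10) * N := by
    calc N * (9 / 10) * Real.log (9 / δ) ≤ (∑ θ, ∫ u, S θ u ∂P.μ) * Real.log (9 / δ) := by
          refine mul_le_mul_of_nonneg_right ?_ hlog9.le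
          have : ∑ θ : Θ, (9 / 10 : ℝ) ≤ ∑ θ, ∫ u, S θ u ∂P.μ :=
            Finset.sum_le_sum fun θ _ => hSP θ ▸ hP θ
          simpa using this
      _ = ∫ u, (∑ θ, S θ u) * Real.log (9 / δ) ∂P.μ := by
          rw [integral_mul_const, integral_finsetSum _ fun θ _ => hint θ]
      _ ≤ ∫ _, (n * K + Real.log 10) * N ∂P.μ := by
          refine integral_mono ?_ (integrable_const _) hu
          exact (integrable_finsetSum _ fun θ _ => hint θ).mul_const _
      _ = _ := by simp
  have hfin : 9 / 10 * Real.log (9 / δ) ≤ n * K + Real.log 10 := by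
    refine le_of_mul_le_mul_right ?_ hN0
    linarith
  rw [Real.log_div (by norm_num) hδ.ne'] at hfin
  rw [one_div, Real.log_inv]
  have h2 : Real.log δ ≤ - Real.log 2 := by
    rw [← Real.log_inv]
    exact Real.log_le_log hδ (by linarith)
  -- This numerical inequality, with `log (1 / δ) ≥ log 2`, absorbs `log 10 - (9/10) log 9` and
  -- lowers the coefficient from `9/10` to `2/5`.
  have h3 : 10 * Real.log 10 ≤ 9 * Real.log 9 + 5 * Real.log 2 := by
    have : Real.log ((10 : ℝ) ^ 10) ≤ Real.log (9 ^ 9 * 2 ^ 5) :=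
      Real.log_le_log (by norm_num) (by norm_num)
    rw [Real.log_mul (by norm_num) (by norm_num), Real.log_pow, Real.log_pow, Real.log_pow] at this
    push_cast at this
    exact this
  linarith

/-- The lower bound for a family of distributions indexed by `[b]^m` whose message laws are sums of
coordinatewise perturbations of the law of a central distribution. -/
theorem mul_log_le_of_successProb {k n m b : ℕ} (hm : 1 ≤ m) (hb : 2 ≤ b) {Y : Type} [Fintype Y]
    {𝒲 : Set (Channel k Y)} (P : PublicCoinProtocol k n Y 𝒲)
    (p : (Fin m → Fin b) → stdSimplex ℝ (Fin k)) {α K : ℝ}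
    (hP : ∀ f, (9 / 10 : ℝ) ≤ P.successProb tvDist α (p f))
    (hdist : ∀ f g, ∑ x, |(p f).1 x - (p g).1 x| ≤ 4 * α → 4 * hammingDist f g ≤ m)
    (c : stdSimplex ℝ (Fin k)) (hc : ∀ f x, c.1 x = 0 → (p f).1 x = 0)
    (hK : ∀ W : Channel k Y, ∃ (X : Y → Fin m → Fin b → ℝ) (κ : Y → ℝ),
      (∀ y j, ∑ a, X y j a = 0) ∧
      (∀ y f, W.output (p f) y = W.output c y + ∑ j, X y j (f j)) ∧
      (∀ y, ∑ j, ∑ a, X y j a ^ 2 ≤ b * (κ y * W.output c y)) ∧ (∀ y, 0 ≤ κ y) ∧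
      ∑ y, κ y ≤ K) :
    3 / 50 * m * Real.log b ≤ n * K := by
  classical
  have hb0 : (0 : ℝ) < b := by positivity
  have : NeZero b := ⟨by omega⟩
  set δ := min (1 / 2) (Real.exp (-(3 / 20 * m * Real.log b))) with hδ
  have hδ0 : 0 < δ := lt_min (by norm_num) (Real.exp_pos _)
  have hcard : (Fintype.card (Fin m → Fin b) : ℝ) = (b : ℝ) ^ m := by simp
  have hlog : 3 / 20 * m * Real.log b ≤ Real.log (1 / δ) := by
    rw [one_div, Real.log_inv, le_neg]
    have := Real.log_le_log hδ0 (min_le_right (1 / 2 : ℝ) (Real.exp (-(3 / 20 * m * Real.log b))))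
    rwa [Real.log_exp] at this
  refine le_trans ?_ (log_inv_le_of_successProb P p hP hδ0 (min_le_left _ _) ?_ c hc
    (K := K) ?_)
  · linarith
  · intro q
    rw [hcard]
    rcases (Finset.univ.filter fun f => tvDist (p f) q ≤ α).eq_empty_or_nonempty with h | ⟨g, hg⟩
    · rw [h]; simp; positivity
    · have hsub : (Finset.univ.filter fun f => tvDist (p f) q ≤ α) ⊆
          Finset.univ.filter fun f => 4 * hammingDist f g ≤ m := by
        intro f hf
        simp only [Finset.mem_filter, Finset.mem_univ, true_and] at hf hg ⊢
        refine hdist f g ?_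
        simp only [tvDist] at hf hg
        calc _ ≤ ∑ x, (|(p f).1 x - q.1 x| + |(p g).1 x - q.1 x|) := by
              refine Finset.sum_le_sum fun x _ => ?_
              rw [abs_sub_comm ((p g).1 x)]
              exact abs_sub_le _ _ _
          _ ≤ 4 * α := by rw [Finset.sum_add_distrib]; linarith
      refine (Nat.cast_le.2 (Finset.card_le_card hsub)).trans ?_
      rw [hδ, min_mul_of_nonneg _ _ (by positivity)]
      refine le_min ?_ (card_hammingBall_le hb g)
      have := (Nat.cast_le (α := ℝ)).2 (two_mul_card_hammingBall_le hb hm g)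
      rw [Nat.cast_mul, Nat.cast_pow, Nat.cast_two] at this
      linarith
  · intro W
    obtain ⟨X, κ, hX, hW, hXκ, hκ, hκK⟩ := hK W
    rw [hcard]
    have hpt : ∀ f y, W.output (p f) y * (W.output (p f) y / W.output c y - 1) =
        (∑ j, X y j (f j)) ^ 2 / W.output c y + (W.output (p f) y - W.output c y) := by
      intro f y
      -- Where the central law vanishes, so does the perturbed one, and both sides are `0` because
      -- division by zero gives `0`.
      by_cases h0 : W.output c y = 0
      · have := Channel.output_eq_zero W (hc f) h0
        simp [h0, this]
      · rw [hW y f]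
        field_simp
        ring
    have hy : ∀ y, (∑ f : Fin m → Fin b, (∑ j, X y j (f j)) ^ 2) / W.output c y ≤ κ y * (b : ℝ) ^ m := by
      intro y
      have h1 := sum_sq_sum_apply (X y) (hX y)
      have h2 := hXκ y
      refine div_le_of_le_mul₀ (Channel.output_nonneg _ _ _)
        (mul_nonneg (hκ y) (by positivity)) ?_
      refine le_of_mul_le_mul_left ?_ hb0
      rw [h1]
      calc _ ≤ (b : ℝ) ^ m * (b * (κ y * W.output c y)) := by gcongr
        _ = _ := by ring
    simp only [hpt, Finset.sum_add_distrib, Finset.sum_sub_distrib, Channel.sum_output, sub_self,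
      add_zero]
    rw [Finset.sum_comm]
    simp only [← Finset.sum_div]
    calc _ ≤ ∑ y, κ y * (b : ℝ) ^ m := Finset.sum_le_sum fun y _ => hy y
      _ ≤ _ := by rw [← Finset.sum_mul]; gcongr

/-! ### Transport of distributions into `[k]` -/

/-- The image of a probability vector under an injection of index types. -/
def pushforward {k : ℕ} {J : Type*} [Fintype J] (ι : J ↪ Fin k) (w : stdSimplex ℝ J) :
    stdSimplex ℝ (Fin k) :=
  ⟨Function.extend ι w.1 0, by
    constructor
    · intro x
      by_cases hx : ∃ j, ι j = x
      · obtain ⟨j, rfl⟩ := hx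
        rw [ι.injective.extend_apply]
        exact w.2.1 j
      · rw [Function.extend_apply' _ _ _ hx]; rfl
    · rw [← w.2.2]
      refine (Fintype.sum_of_injective ι ι.injective _ _ ?_ ?_).symm
      · intro x hx
        exact Function.extend_apply' _ _ _ hx
      · intro j
        exact (ι.injective.extend_apply _ _ _).symm⟩

theorem pushforward_apply {k : ℕ} {J : Type*} [Fintype J] (ι : J ↪ Fin k) (w : stdSimplex ℝ J)
    (j : J) : (pushforward ι w).1 (ι j) = w.1 j :=
  ι.injective.extend_apply _ _ _

theorem pushforward_apply_of_notMem {k : ℕ} {J : Type*} [Fintype J] (ι : J ↪ Fin k)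
    (w : stdSimplex ℝ J) {x : Fin k} (hx : x ∉ Set.range ι) : (pushforward ι w).1 x = 0 :=
  Function.extend_apply' _ _ _ hx

theorem output_pushforward {k : ℕ} {J : Type*} [Fintype J] {Y : Type} [Fintype Y]
    (W : Channel k Y) (ι : J ↪ Fin k) (w : stdSimplex ℝ J) (y : Y) :
    W.output (pushforward ι w) y = ∑ j, w.1 j * (W (ι j)).1 y := by
  refine (Fintype.sum_of_injective ι ι.injective _ _ ?_ ?_).symm
  · intro x hx
    rw [pushforward_apply_of_notMem ι w hx, zero_mul]
  · intro j
    rw [pushforward_apply]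

theorem sum_abs_pushforward_sub {k : ℕ} {J : Type*} [Fintype J] (ι : J ↪ Fin k)
    (v w : stdSimplex ℝ J) :
    ∑ x, |(pushforward ι v).1 x - (pushforward ι w).1 x| = ∑ j, |v.1 j - w.1 j| := by
  refine (Fintype.sum_of_injective ι ι.injective _ _ ?_ ?_).symm
  · intro x hx
    rw [pushforward_apply_of_notMem ι v hx, pushforward_apply_of_notMem ι w hx, sub_zero, abs_zero]
  · intro j
    rw [pushforward_apply, pushforward_apply]

theorem pushforward_mem_sparseDistributions {k s : ℕ} {J : Type*} [Fintype J] (ι : J ↪ Fin k)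
    (w : stdSimplex ℝ J) (t : Finset J) (ht : t.card ≤ s) (hw : ∀ j ∉ t, w.1 j = 0) :
    pushforward ι w ∈ sparseDistributions k s := by
  have hsub : {x | (pushforward ι w).1 x ≠ 0} ⊆ (t.map ι : Set (Fin k)) := by
    intro x hx
    by_cases hr : x ∈ Set.range ι
    · obtain ⟨j, rfl⟩ := hr
      have : (pushforward ι w).1 (ι j) ≠ 0 := hx
      rw [pushforward_apply] at this
      have hj : j ∈ t := by
        by_contra h
        exact this (hw j h)
      simpa using hj
    · exact absurd (pushforward_apply_of_notMem ι w hr) hx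
  have := Set.ncard_le_ncard hsub (Finset.finite_toSet _)
  rw [Set.ncard_coe_finset, Finset.card_map] at this
  exact this.trans ht

theorem pushforward_eq_zero {k : ℕ} {J : Type*} [Fintype J] (ι : J ↪ Fin k)
    {v w : stdSimplex ℝ J} (h : ∀ j, w.1 j = 0 → v.1 j = 0) (x : Fin k)
    (hx : (pushforward ι w).1 x = 0) : (pushforward ι v).1 x = 0 := by
  by_cases hr : x ∈ Set.range ι
  · obtain ⟨j, rfl⟩ := hr
    rw [pushforward_apply] at hx ⊢
    exact h j hx
  · exact pushforward_apply_of_notMem ι v hr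

theorem stdSimplex_sq_le {Y : Type*} [Fintype Y] (w : stdSimplex ℝ Y) (y : Y) :
    w.1 y ^ 2 ≤ w.1 y := by
  have := mem_Icc_of_mem_stdSimplex w.2 y
  nlinarith [this.1, this.2]

/-! ### First family: sign perturbations on pairs -/

/-- `1` or `-1` according to whether `a = c`. -/
def agreeSign (a c : Fin 2) : ℝ := if a = c then 1 else -1

/-- A perturbation of the uniform distribution on `m` pairs by the signs `f`. -/
def paninski {m : ℕ} (hm : 1 ≤ m) (γ : ℝ) (hγ0 : 0 ≤ γ) (hγ : γ ≤ 1) (f : Fin m → Fin 2) :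
    stdSimplex ℝ (Fin m × Fin 2) :=
  ⟨fun j => (1 + γ * agreeSign (f j.1) j.2) / (2 * m), by
    constructor
    · intro j
      have : -1 ≤ agreeSign (f j.1) j.2 := by unfold agreeSign; split_ifs <;> norm_num
      have : 0 ≤ 1 + γ * agreeSign (f j.1) j.2 := by nlinarith
      positivity
    · have h : ∀ a : Fin 2, (1 + γ * agreeSign a 0) / (2 * m : ℝ) +
          (1 + γ * agreeSign a 1) / (2 * m) = 1 / m := by
        intro a
        fin_cases a <;> simp [agreeSign] <;> field_simp <;> ring
      have hm0 : (m : ℝ) ≠ 0 := by positivity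
      rw [Fintype.sum_prod_type]
      simp only [Fin.sum_univ_two, h]
      simp [hm0]⟩

theorem sum_abs_paninski_sub {m : ℕ} (hm : 1 ≤ m) (γ : ℝ) (hγ0 : 0 ≤ γ) (hγ : γ ≤ 1)
    (f g : Fin m → Fin 2) :
    ∑ j, |(paninski hm γ hγ0 hγ f).1 j - (paninski hm γ hγ0 hγ g).1 j| =
      2 * γ / m * hammingDist f g := by
  have hm0 : (0 : ℝ) < m := by positivity
  have h : ∀ a c : Fin 2, |(1 + γ * agreeSign a 0) / (2 * m : ℝ) -
      (1 + γ * agreeSign c 0) / (2 * m)| + |(1 + γ * agreeSign a 1) / (2 * m : ℝ) -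
      (1 + γ * agreeSign c 1) / (2 * m)| = 2 * γ / m * if a ≠ c then 1 else 0 := by
    intro a c
    have h1 : (1 + γ) / (2 * m : ℝ) - (1 + γ * (-1)) / (2 * m) = γ / m := by field_simp; ring
    have h2 : (1 + γ * (-1)) / (2 * m : ℝ) - (1 + γ) / (2 * m) = -(γ / m) := by field_simp; ring
    have h3 : 0 ≤ γ / m := by positivity
    fin_cases a <;> fin_cases c <;>
      simp only [agreeSign, Fin.zero_eta, Fin.mk_one, if_true, Fin.isValue, zero_ne_one, one_ne_zero,
        if_false, mul_one, h1, h2, sub_self, abs_zero, abs_neg, abs_of_nonneg h3, ne_eq,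
        not_true_eq_false, not_false_eq_true] <;> ring
  rw [Fintype.sum_prod_type]
  simp only [Fin.sum_univ_two, paninski, h]
  rw [← Finset.mul_sum, Finset.sum_boole]
  rfl

/-- The two conclusions correspond to the two values of `min (2^ℓ) s`: the first reflects limited
communication, the second the information in the unquantized sample. The amplitude `8α` makes
distance `4α` in ℓ¹ correspond to Hamming distance `m/4`. -/
theorem paninski_lower_bound {k n m : ℕ} (hm : 1 ≤ m) {s : ℕ} (hs : 2 * m ≤ s) (hk : 2 * m ≤ k)
    {Y : Type} [Fintype Y] {𝒲 : Set (Channel k Y)} (P : PublicCoinProtocol k n Y 𝒲) {α : ℝ}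
    (hα0 : 0 < α) (hα : α ≤ 1 / 8)
    (hP : ∀ p ∈ sparseDistributions k s, (9 / 10 : ℝ) ≤ P.successProb tvDist α p) :
    3 / 50 * m * Real.log 2 ≤ n * ((8 * α) ^ 2 / (2 * m) * Fintype.card Y) ∧
      3 / 50 * m * Real.log 2 ≤ n * (8 * α) ^ 2 := by
  have hm0 : (0 : ℝ) < m := by positivity
  obtain ⟨ι⟩ : Nonempty (Fin m × Fin 2 ↪ Fin k) := by
    rw [Function.Embedding.nonempty_iff_card_le]
    simp; omega
  set γ := 8 * α with hγ
  have hγ0 : 0 ≤ γ := by positivity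
  have hγ1 : γ ≤ 1 := by linarith
  set c : stdSimplex ℝ (Fin k) :=
    pushforward ι (paninski hm 0 le_rfl zero_le_one fun _ => 0) with hcdef
  have hout : ∀ (W : Channel k Y) y, W.output c y =
      ∑ j, ((W (ι (j, 0))).1 y + (W (ι (j, 1))).1 y) / (2 * m) := by
    intro W y
    rw [hcdef, output_pushforward, Fintype.sum_prod_type]
    refine Finset.sum_congr rfl fun j _ => ?_
    simp [paninski]
    ring
  have key : ∀ K : ℝ, (∀ W : Channel k Y, ∃ κ : Y → ℝ, (∀ y, ∑ j,
      (γ / (2 * m) * ((W (ι (j, 0))).1 y - (W (ι (j, 1))).1 y)) ^ 2 ≤ κ y * W.output c y) ∧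
      (∀ y, 0 ≤ κ y) ∧ ∑ y, κ y ≤ K) → 3 / 50 * m * Real.log 2 ≤ n * K := by
    intro K hK
    refine mul_log_le_of_successProb (b := 2) hm le_rfl P
      (fun f => pushforward ι (paninski hm γ hγ0 hγ1 f)) (α := α) (fun f => hP _ ?_) ?_ c ?_ ?_
    · exact pushforward_mem_sparseDistributions ι _ Finset.univ (by simp; omega) (by simp)
    · intro f g h
      rw [sum_abs_pushforward_sub, sum_abs_paninski_sub, hγ, div_mul_eq_mul_div,
        div_le_iff₀ hm0] at h
      have : (4 * hammingDist f g : ℝ) ≤ m := by nlinarith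
      exact_mod_cast this
    · intro f
      refine pushforward_eq_zero ι fun j hj => ?_
      simp [paninski] at hj
      omega
    · intro W
      obtain ⟨κ, h1, h2, h3⟩ := hK W
      refine ⟨fun y j a => γ / (2 * m) * agreeSign a 0 *
        ((W (ι (j, 0))).1 y - (W (ι (j, 1))).1 y), κ, ?_, ?_, ?_, h2, h3⟩
      · intro y j
        simp [Fin.sum_univ_two, agreeSign]
      · intro y f
        rw [hout, output_pushforward, Fintype.sum_prod_type, ← Finset.sum_add_distrib]
        refine Finset.sum_congr rfl fun j _ => ?_
        have : agreeSign (f j) 1 = - agreeSign (f j) 0 := by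
          generalize f j = a
          fin_cases a <;> simp [agreeSign]
        simp only [Fin.sum_univ_two, paninski, this]
        field_simp
        ring
      · intro y
        refine le_trans (le_of_eq ?_) (mul_le_mul_of_nonneg_left (h1 y) (by norm_num))
        rw [Finset.mul_sum]
        refine Finset.sum_congr rfl fun j _ => ?_
        simp [agreeSign]
  constructor
  -- Communication bound: `(v - w)² ≤ v + w` for `v, w ∈ [0, 1]`, giving the same `κ` for each of
  -- the `2^ℓ` messages when `Y` is the set of `ℓ`-bit strings.
  · refine key _ fun W => ⟨fun _ => γ ^ 2 / (2 * m), fun y => ?_, fun y => by positivity, ?_⟩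
    · rw [hout, Finset.mul_sum]
      refine Finset.sum_le_sum fun j _ => ?_
      have h0 := stdSimplex_sq_le (W (ι (j, 0))) y
      have h1 := stdSimplex_sq_le (W (ι (j, 1))) y
      have h2 := mul_nonneg ((W (ι (j, 0))).2.1 y) ((W (ι (j, 1))).2.1 y)
      calc _ = (γ / (2 * m)) ^ 2 * ((W (ι (j, 0))).1 y - (W (ι (j, 1))).1 y) ^ 2 := by ring
        _ ≤ (γ / (2 * m)) ^ 2 * ((W (ι (j, 0))).1 y + (W (ι (j, 1))).1 y) := by
          gcongr
          nlinarith
        _ = _ := by field_simp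
    · simp [mul_comm]
  -- Sample bound: `|v - w| ≤ v + w` and a sum of squares is at most the square of the sum, so `κ`
  -- is `γ²` times the message law, of total mass `γ²`.
  · refine key _ fun W => ⟨fun y => γ ^ 2 * W.output c y, fun y => ?_,
      fun y => mul_nonneg (sq_nonneg _) (Channel.output_nonneg _ _ _), ?_⟩
    · have h0 : ∀ j, 0 ≤ ((W (ι (j, 0))).1 y + (W (ι (j, 1))).1 y) / (2 * m) := fun j =>
        div_nonneg (add_nonneg ((W _).2.1 y) ((W _).2.1 y)) (by positivity)
      have h1 : ∑ j, (((W (ι (j, 0))).1 y + (W (ι (j, 1))).1 y) / (2 * m)) ^ 2 ≤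
          W.output c y ^ 2 := by
        rw [hout]
        exact Finset.sum_sq_le_sq_sum_of_nonneg fun j _ => h0 j
      calc _ ≤ ∑ j, γ ^ 2 * (((W (ι (j, 0))).1 y + (W (ι (j, 1))).1 y) / (2 * m)) ^ 2 := by
            refine Finset.sum_le_sum fun j _ => ?_
            have h2 := mul_nonneg ((W (ι (j, 0))).2.1 y) ((W (ι (j, 1))).2.1 y)
            rw [mul_pow, div_pow, div_pow, div_mul_eq_mul_div, mul_div_assoc]
            gcongr ?_ * (?_ / _)
            nlinarith
        _ ≤ _ := by
            rw [← Finset.mul_sum, mul_assoc, ← sq]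
            exact mul_le_mul_of_nonneg_left h1 (sq_nonneg _)
    · rw [← Finset.mul_sum, Channel.sum_output, mul_one]

/-! ### Second family: graphs of functions mixed with a point mass -/

/-- The mixture of a point mass with the uniform distribution on the graph of `f`. -/
def graphMixture {m b : ℕ} (hm : 1 ≤ m) (β : ℝ) (hβ0 : 0 ≤ β) (hβ : β ≤ 1) (f : Fin m → Fin b) :
    stdSimplex ℝ (Option (Fin m × Fin b)) :=
  ⟨fun o => o.elim (1 - β) fun j => if f j.1 = j.2 then β / m else 0, by
    constructor
    · rintro (_ | j)
      · simpa using hβ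
      · simp only [Option.elim_some]
        split_ifs <;> positivity
    · have hm0 : (m : ℝ) ≠ 0 := by positivity
      rw [Fintype.sum_option, Fintype.sum_prod_type]
      simp
      field_simp
      ring⟩

/-- The mixture of a point mass with a uniform distribution. -/
def uniformMixture {m b : ℕ} (hm : 1 ≤ m) (hb : 1 ≤ b) (β : ℝ) (hβ0 : 0 ≤ β) (hβ : β ≤ 1) :
    stdSimplex ℝ (Option (Fin m × Fin b)) :=
  ⟨fun o => o.elim (1 - β) fun _ => β / m / b, by
    constructor
    · rintro (_ | j)
      · simpa using hβ
      · simp only [Option.elim_some]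
        positivity
    · have hm0 : (m : ℝ) ≠ 0 := by positivity
      have hb0 : (b : ℝ) ≠ 0 := by positivity
      rw [Fintype.sum_option]
      simp
      field_simp
      ring⟩

theorem sum_abs_graphMixture_sub {m b : ℕ} (hm : 1 ≤ m) (β : ℝ) (hβ0 : 0 ≤ β) (hβ : β ≤ 1)
    (f g : Fin m → Fin b) :
    ∑ j, |(graphMixture hm β hβ0 hβ f).1 j - (graphMixture hm β hβ0 hβ g).1 j| =
      2 * β / m * hammingDist f g := by
  have h : ∀ a c : Fin b, ∑ x, |(if a = x then β / m else 0) - (if c = x then β / m else 0)| =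
      2 * β / m * if a ≠ c then 1 else 0 := by
    intro a c
    have h3 : 0 ≤ β / m := by positivity
    by_cases hac : a = c
    · simp [hac]
    · have : ∀ x, |(if a = x then β / m else 0) - (if c = x then β / m else 0)| =
          (if a = x then β / m else 0) + (if c = x then β / m else 0) := by
        intro x
        by_cases h1 : a = x
        · subst h1
          simpa [Ne.symm hac] using h3
        · simp only [h1, if_false, zero_sub, abs_neg, zero_add]
          split_ifs
          exacts [abs_of_nonneg h3, abs_zero]
      simp only [this, Finset.sum_add_distrib]
      simp [hac]
      ring
  rw [Fintype.sum_option, Fintype.sum_prod_type]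
  simp only [graphMixture, Option.elim_none, Option.elim_some, sub_self, abs_zero, zero_add, h]
  rw [← Finset.mul_sum, Finset.sum_boole]
  rfl

/-- Relative to the uniform mixture, the perturbation at a message has mean square at most `β/m`
times the central probability of that message, the point mass only increasing the latter. Summing
over messages gives `β/m` per element of `Y`. -/
theorem graphMixture_lower_bound {k n m b : ℕ} (hm : 1 ≤ m) (hb : 2 ≤ b) {s : ℕ} (hs : m + 1 ≤ s)
    (hk : m * b + 1 ≤ k)
    {Y : Type} [Fintype Y] {𝒲 : Set (Channel k Y)} (P : PublicCoinProtocol k n Y 𝒲) {α : ℝ}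
    (hα0 : 0 < α) (hα : α ≤ 1 / 8)
    (hP : ∀ p ∈ sparseDistributions k s, (9 / 10 : ℝ) ≤ P.successProb tvDist α p) :
    3 / 50 * m * Real.log b ≤ n * (8 * α / m * Fintype.card Y) := by
  have hm0 : (0 : ℝ) < m := by positivity
  have hb0 : (0 : ℝ) < b := by positivity
  obtain ⟨ι⟩ : Nonempty (Option (Fin m × Fin b) ↪ Fin k) := by
    rw [Function.Embedding.nonempty_iff_card_le]
    simp; omega
  set β := 8 * α with hβ
  have hβ0 : 0 < β := by positivity
  have hβ1 : β ≤ 1 := by linarith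
  refine mul_log_le_of_successProb (b := b) hm hb P
      (fun f => pushforward ι (graphMixture hm β hβ0.le hβ1 f)) (α := α) (fun f => hP _ ?_) ?_
      (pushforward ι (uniformMixture (b := b) hm (by omega) β hβ0.le hβ1)) ?_ ?_
  · classical
    refine pushforward_mem_sparseDistributions ι _
      (insert none (Finset.univ.image fun j => some (j, f j))) ?_ ?_
    · refine (Finset.card_insert_le _ _).trans ?_
      refine le_trans (Nat.add_le_add_right Finset.card_image_le 1) ?_
      simpa using hs
    · rintro (_ | ⟨j, a⟩) hj
      · simp at hj
      · simp at hj
        simp [graphMixture, hj]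
  · intro f g h
    rw [sum_abs_pushforward_sub, sum_abs_graphMixture_sub, hβ, div_mul_eq_mul_div,
      div_le_iff₀ hm0] at h
    have : (4 * hammingDist f g : ℝ) ≤ m := by nlinarith
    exact_mod_cast this
  · intro f
    refine pushforward_eq_zero ι ?_
    rintro (_ | j) hj
    · exact hj
    · simp only [uniformMixture, Option.elim_some] at hj
      exact absurd hj (by positivity)
  · intro W
    -- The perturbation is the deviation of the channel from its mean over block `j`; its squares
    -- sum to at most the sum of the channel probabilities, since these lie in `[0, 1]`.
    refine ⟨fun y j a => β / m * ((W (ι (some (j, a)))).1 y -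
      (∑ a, (W (ι (some (j, a)))).1 y) / b), fun _ => β / m, ?_, ?_, ?_, fun _ => by positivity, ?_⟩
    · intro y j
      rw [← Finset.mul_sum, Finset.sum_sub_distrib]
      simp
      right
      field_simp
      ring
    · intro y f
      rw [output_pushforward, output_pushforward, Fintype.sum_option, Fintype.sum_option,
        Fintype.sum_prod_type, Fintype.sum_prod_type, add_assoc, ← Finset.sum_add_distrib]
      congr 1
      refine Finset.sum_congr rfl fun j _ => ?_
      simp [graphMixture, uniformMixture, ← Finset.mul_sum]
      ring
    · intro y
      rw [output_pushforward, Fintype.sum_option, Fintype.sum_prod_type]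
      have h1 : ∀ j, ∑ a, (β / m * ((W (ι (some (j, a)))).1 y -
          (∑ a, (W (ι (some (j, a)))).1 y) / b)) ^ 2 ≤
          (β / m) ^ 2 * ∑ a, (W (ι (some (j, a)))).1 y := by
        intro j
        simp only [mul_pow, ← Finset.mul_sum]
        refine mul_le_mul_of_nonneg_left ?_ (sq_nonneg _)
        simp only [sub_sq, Finset.sum_add_distrib, Finset.sum_sub_distrib, ← Finset.sum_mul,
          ← Finset.mul_sum]
        have h2 : ∑ a, (W (ι (some (j, a)))).1 y ^ 2 ≤ ∑ a, (W (ι (some (j, a)))).1 y :=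
          Finset.sum_le_sum fun a _ => stdSimplex_sq_le _ y
        set T := ∑ a, (W (ι (some (j, a)))).1 y
        have h3 : 0 ≤ T ^ 2 / b := by positivity
        have h4 : 2 * T * (T / b) = 2 * (T ^ 2 / b) := by ring
        have h5 : ∑ _a : Fin b, (T / b) ^ 2 = T ^ 2 / b := by
          simp; field_simp
        rw [h4, h5]
        linarith
      refine (Finset.sum_le_sum fun j _ => h1 j).trans ?_
      rw [← Finset.mul_sum]
      simp only [uniformMixture, Option.elim_none, Option.elim_some, ← Finset.mul_sum]
      have h6 : 0 ≤ (1 - β) * (W (ι none)).1 y :=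
        mul_nonneg (by linarith) ((W _).2.1 y)
      set T := ∑ j, ∑ a, (W (ι (some (j, a)))).1 y
      calc (β / m) ^ 2 * T = b * (β / m * (0 + β / m / b * T)) := by field_simp; ring
        _ ≤ _ := by gcongr
    · simp [mul_comm]

/-! ### Sample complexity and assembly of the lower bound -/

theorem ofReal_le_sampleComplexity {k : ℕ} {Y : Type} [Fintype Y] {α : ℝ}
    {Δ : Set (stdSimplex ℝ (Fin k))} {𝒲 : Set (Channel k Y)}
    {d : stdSimplex ℝ (Fin k) → stdSimplex ℝ (Fin k) → ℝ} {r : ℝ}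
    (h : ∀ (n : ℕ) (P : PublicCoinProtocol k n Y 𝒲),
      (∀ p ∈ Δ, (9 / 10 : ℝ) ≤ P.successProb d α p) → r ≤ n) :
    ENNReal.ofReal r ≤ (sampleComplexity α Δ 𝒲 d : ENNReal) := by
  have h1 : ((⌈r⌉₊ : ℕ) : ℕ∞) ≤ sampleComplexity α Δ 𝒲 d := by
    refine le_iInf₂ fun n ⟨P, hP⟩ => ?_
    exact_mod_cast Nat.ceil_le.2 (h n P hP)
  calc ENNReal.ofReal r ≤ ENNReal.ofReal ⌈r⌉₊ := ENNReal.ofReal_le_ofReal (Nat.le_ceil r)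
    _ = (((⌈r⌉₊ : ℕ) : ℕ∞) : ENNReal) := by simp
    _ ≤ _ := ENat.toENNReal_mono h1

theorem sampleComplexity_le_ofReal {k n : ℕ} {Y : Type} [Fintype Y] {α : ℝ}
    {Δ : Set (stdSimplex ℝ (Fin k))} {𝒲 : Set (Channel k Y)}
    {d : stdSimplex ℝ (Fin k) → stdSimplex ℝ (Fin k) → ℝ} {r : ℝ}
    (P : PublicCoinProtocol k n Y 𝒲) (hP : ∀ p ∈ Δ, (9 / 10 : ℝ) ≤ P.successProb d α p)
    (hn : (n : ℝ) ≤ r) :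
    (sampleComplexity α Δ 𝒲 d : ENNReal) ≤ ENNReal.ofReal r := by
  have h1 : sampleComplexity α Δ 𝒲 d ≤ n := iInf₂_le n ⟨P, hP⟩
  calc (sampleComplexity α Δ 𝒲 d : ENNReal) ≤ ((n : ℕ∞) : ENNReal) := ENat.toENNReal_mono h1
    _ = ENNReal.ofReal n := by simp
    _ ≤ _ := ENNReal.ofReal_le_ofReal hn

theorem sparse_lower_bound {k s ℓ n : ℕ} {α : ℝ} (hs : 2 ≤ s) (hk : 100 * s ≤ k)
    (hα0 : 0 < α) (hα : α ≤ 1 / 8) {𝒲 : Set (Channel k (Fin ℓ → Bool))}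
    (P : PublicCoinProtocol k n (Fin ℓ → Bool) 𝒲)
    (hP : ∀ p ∈ sparseDistributions k s, (9 / 10 : ℝ) ≤ P.successProb tvDist α p) :
    1 / 10000 * max ((s : ℝ) ^ 2 / (α ^ 2 * min ((2 : ℝ) ^ ℓ) s))
      ((s : ℝ) ^ 2 * max (Real.log ((k : ℝ) / s)) 1 / (α * (2 : ℝ) ^ ℓ)) ≤ n := by
  have hcard : (Fintype.card (Fin ℓ → Bool) : ℝ) = 2 ^ ℓ := by simp
  have hs0 : (0 : ℝ) < s := by positivity
  have h2ℓ : (0 : ℝ) < 2 ^ ℓ := by positivity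
  have hn0 : (0 : ℝ) ≤ n := by positivity
  rw [mul_max_of_nonneg _ _ (by norm_num)]
  refine max_le ?_ ?_
  · obtain ⟨m, hm⟩ : ∃ m, m = s / 2 := ⟨_, rfl⟩
    have hm1 : 1 ≤ m := by omega
    have hms : (s : ℝ) ≤ 3 * m := by
      have : s ≤ 3 * m := by omega
      exact_mod_cast this
    have hm0 : (0 : ℝ) < m := by positivity
    obtain ⟨h1, h2⟩ := paninski_lower_bound (s := s) hm1 (by omega) (by omega) P hα0 hα hP
    have hlog := Real.log_two_gt_d9
    have hlog' : 69 / 100 < Real.log 2 := by linarith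
    have hmlog : 3 / 50 * (m : ℝ) * (69 / 100) ≤ 3 / 50 * m * Real.log 2 := by gcongr
    have hα2 : 0 < α ^ 2 := by positivity
    rw [mul_div_assoc', div_le_iff₀ (mul_pos hα2 (lt_min h2ℓ hs0)), ← mul_assoc]
    rcases min_choice ((2 : ℝ) ^ ℓ) s with h | h <;> rw [h]
    · rw [hcard] at h1
      have h3 : n * ((8 * α) ^ 2 / (2 * m) * 2 ^ ℓ) * m = 32 * (n * α ^ 2 * 2 ^ ℓ) := by
        field_simp; ring
      have h4 := mul_le_mul_of_nonneg_right (hmlog.trans h1) hm0.le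
      rw [h3] at h4
      nlinarith
    · have h3 : 3 / 50 * (m : ℝ) * (69 / 100) ≤ 64 * (n * α ^ 2) := by linarith
      have h4 : 1 / 10000 * (s : ℝ) ≤ n * α ^ 2 := by linarith
      nlinarith
  -- One of the `s` support points is spent on the point mass. With `b = ⌊k/s⌋ ≥ 100` one has `k/s <
  -- b + 1 ≤ b²`, so `log b` is at least half of `log (k/s)`.
  · obtain ⟨m, rfl⟩ : ∃ m, s = m + 1 := ⟨s - 1, by omega⟩
    obtain ⟨b, hb⟩ : ∃ b, b = k / (m + 1) := ⟨_, rfl⟩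
    have hm1 : 1 ≤ m := by omega
    have hm0 : (0 : ℝ) < m := by positivity
    have hb100 : 100 ≤ b := by
      rw [hb, Nat.le_div_iff_mul_le (by omega)]; omega
    have hkb : k < (b + 1) * (m + 1) := by
      have := Nat.lt_div_mul_add (a := k) (b := m + 1) (by omega)
      rw [← hb] at this
      linarith
    have hbk : b * (m + 1) ≤ k := by rw [hb]; exact Nat.div_mul_le_self _ _
    have h1 := graphMixture_lower_bound (s := m + 1) (b := b) hm1 (by omega) le_rfl
      (by linarith) P hα0 hα hP
    rw [hcard] at h1
    have hb0 : (0 : ℝ) < b := by positivity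
    have hk0 : (0 : ℝ) < k := by
      have : 0 < k := by omega
      exact_mod_cast this
    have hdiv : (k : ℝ) / (m + 1 : ℕ) ≤ (b : ℝ) ^ 2 := by
      rw [div_le_iff₀ hs0]
      have h3 : k ≤ b ^ 2 * (m + 1) :=
        hkb.le.trans (Nat.mul_le_mul_right _ (by nlinarith))
      exact_mod_cast h3
    have hL : max (Real.log ((k : ℝ) / (m + 1 : ℕ))) 1 ≤ 2 * Real.log b := by
      refine max_le ?_ ?_
      · have := Real.log_le_log (by positivity) hdiv
        rwa [Real.log_pow, Nat.cast_two] at this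
      · have h3 : Real.log 2 ≤ Real.log b := by
          apply Real.log_le_log (by norm_num)
          have : 2 ≤ b := by omega
          exact_mod_cast this
        linarith [Real.log_two_gt_d9]
    rw [mul_div_assoc', div_le_iff₀ (by positivity)]
    have h3 : n * (8 * α / m * 2 ^ ℓ) * m = 8 * (n * (α * 2 ^ ℓ)) := by
      field_simp
    have h4 := mul_le_mul_of_nonneg_right h1 hm0.le
    rw [h3] at h4
    have hlogb : 0 ≤ Real.log b := Real.log_nonneg (by exact_mod_cast (by omega : 1 ≤ b))
    have hm2 : ((m + 1 : ℕ) : ℝ) ^ 2 ≤ 4 * (m : ℝ) ^ 2 := by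
      have : (m + 1 : ℕ) ^ 2 ≤ 4 * m ^ 2 := by nlinarith
      exact_mod_cast this
    calc _ ≤ 1 / 10000 * (4 * (m : ℝ) ^ 2 * (2 * Real.log b)) := by gcongr
      _ ≤ _ := by
        have := mul_nonneg (sq_nonneg (m : ℝ)) hlogb
        linarith

/-! ### The hashing protocol -/

/-- The protocol whose public randomness is uniform on a finite type. -/
def uniformProtocol {k n : ℕ} {Y : Type} [Fintype Y] {𝒲 : Set (Channel k Y)} (Ω : Type) [Fintype Ω]
    [Nonempty Ω] (channel : Ω → Fin n → Channel k Y) (channel_mem : ∀ u i, channel u i ∈ 𝒲)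
    (estimator : Ω → (Fin n → Y) → stdSimplex ℝ (Fin k)) : PublicCoinProtocol k n Y 𝒲 :=
  letI : MeasurableSpace Ω := ⊤
  { Ω := Ω
    μ := (PMF.uniformOfFintype Ω).toMeasure
    channel := channel
    channel_mem := channel_mem
    measurable_channel := fun _ _ _ => measurable_from_top
    estimator := estimator
    measurable_estimator := fun _ _ => measurable_from_top }

open Classical in
theorem successProb_uniformProtocol {k n : ℕ} {Y : Type} [Fintype Y] {𝒲 : Set (Channel k Y)}
    (Ω : Type) [Fintype Ω] [Nonempty Ω] (channel : Ω → Fin n → Channel k Y)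
    (channel_mem : ∀ u i, channel u i ∈ 𝒲)
    (estimator : Ω → (Fin n → Y) → stdSimplex ℝ (Fin k))
    (d : stdSimplex ℝ (Fin k) → stdSimplex ℝ (Fin k) → ℝ) (α : ℝ) (p : stdSimplex ℝ (Fin k)) :
    (uniformProtocol Ω channel channel_mem estimator).successProb d α p =
      (Fintype.card Ω : ℝ)⁻¹ * ∑ u, ∑ y : Fin n → Y, (∏ i, (channel u i).output p (y i)) *
        (if d p (estimator u y) ≤ α then 1 else 0) := by
  let _ : MeasurableSpace Ω := ⊤
  have : MeasurableSingletonClass Ω := ⟨fun _ => trivial⟩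
  refine (PMF.integral_eq_sum (PMF.uniformOfFintype Ω) _).trans ?_
  rw [Finset.mul_sum]
  refine Finset.sum_congr rfl fun u _ => ?_
  simp [PMF.uniformOfFintype_apply]
  rfl

/-- The deterministic channel `x ↦ e (h x)`. -/
def hashChannel {k M : ℕ} {Y : Type} [Fintype Y] [DecidableEq Y] (e : Fin M ↪ Y)
    (h : Fin k → Fin M) : Channel k Y :=
  fun x => ⟨Pi.single (e (h x)) 1, single_mem_stdSimplex ℝ _⟩

theorem sum_output_hashChannel_mul {k M : ℕ} {Y : Type} [Fintype Y] [DecidableEq Y]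
    (e : Fin M ↪ Y) (h : Fin k → Fin M) (p : stdSimplex ℝ (Fin k)) (g : Y → ℝ) :
    ∑ y, (hashChannel e h).output p y * g y = ∑ x, p.1 x * g (e (h x)) := by
  simp only [Channel.output, hashChannel, Finset.sum_mul]
  rw [Finset.sum_comm]
  refine Finset.sum_congr rfl fun x _ => ?_
  simp [Pi.single_apply]

/-! ### Exponential moments of collision counts -/

theorem exp_le_one_add_add_sq {v : ℝ} (hv : |v| ≤ 1) : Real.exp v ≤ 1 + v + v ^ 2 := by
  have := (abs_le.1 (Real.abs_exp_sub_one_sub_id_le hv)).2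
  linarith

/-- The centred indicator has variance at most `1/M`, and the linear term of the exponential cancels
in the sum. -/
theorem sum_exp_indicator_le {M : ℕ} (hM : 1 ≤ M) (b : Fin M) {v : ℝ} (hv : |v| ≤ 1) :
    ∑ c : Fin M, Real.exp (v * ((if b = c then 1 else 0) - 1 / M)) ≤
      M * Real.exp (v ^ 2 / M) := by
  have hM0 : (0 : ℝ) < M := by positivity
  have hM1 : (1 : ℝ) ≤ M := by exact_mod_cast hM
  have h1M : 1 / (M : ℝ) ≤ 1 := by rw [div_le_one hM0]; exact hM1
  have h0M : 0 < 1 / (M : ℝ) := by positivity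
  have hpt : ∀ c : Fin M, Real.exp (v * ((if b = c then 1 else 0) - 1 / M)) ≤
      1 + v * ((if b = c then 1 else 0) - 1 / M) +
        v ^ 2 * ((if b = c then 1 - 2 / (M : ℝ) else 0) + 1 / M ^ 2) := by
    intro c
    have h1 : |v * ((if b = c then 1 else 0) - 1 / (M : ℝ))| ≤ 1 := by
      rw [abs_mul]
      refine mul_le_one₀ hv (abs_nonneg _) ?_
      rw [abs_le]
      split_ifs <;> constructor <;> linarith
    refine (exp_le_one_add_add_sq h1).trans (le_of_eq ?_)
    split_ifs <;> ring
  refine (Finset.sum_le_sum fun c _ => hpt c).trans ?_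
  simp only [Finset.sum_add_distrib, ← Finset.mul_sum, Finset.sum_sub_distrib, Finset.sum_ite_eq,
    Finset.mem_univ, if_true, Finset.sum_const, Finset.card_univ, Fintype.card_fin, nsmul_eq_mul]
  calc _ = M * (v ^ 2 * (1 / M - 1 / M ^ 2) + 1) := by field_simp; ring
    _ ≤ M * (v ^ 2 / M + 1) := by
      gcongr
      rw [mul_sub, mul_one_div]
      linarith [show 0 ≤ v ^ 2 * (1 / (M : ℝ) ^ 2) by positivity]
    _ ≤ _ := by gcongr; exact Real.add_one_le_exp _

/-- Moment generating function of the collisions with `x` of a uniformly random hash function. -/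
theorem sum_exp_collisions_le {k M : ℕ} (hM : 1 ≤ M) (v : Fin k → ℝ) (hv : ∀ x, |v x| ≤ 1)
    (x : Fin k) :
    ∑ h : Fin k → Fin M, Real.exp (∑ z, v z * ((if h x = h z then 1 else 0) - 1 / M)) ≤
      (M : ℝ) ^ k * (Real.exp (∑ z, v z ^ 2 / M) * Real.exp (v x * (1 - 1 / M))) := by
  have hM0 : (0 : ℝ) < M := by positivity
  -- Splitting according to the value `b` of `h x` makes the summand a product over `z`; the extra
  -- indicator enforces `h x = b`. The term `z = x` always collides, whence the separate factor.
  set g : Fin M → Fin k → Fin M → ℝ := fun b z c =>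
    (if z = x then (if b = c then 1 else 0) else 1) *
      Real.exp (v z * ((if b = c then 1 else 0) - 1 / M)) with hg
  have h1 : ∀ h : Fin k → Fin M,
      Real.exp (∑ z, v z * ((if h x = h z then 1 else 0) - 1 / M)) = ∑ b, ∏ z, g b z (h z) := by
    intro h
    have : ∀ b, ∏ z, g b z (h z) = if b = h x then
        Real.exp (∑ z, v z * ((if b = h z then 1 else 0) - 1 / M)) else 0 := by
      intro b
      rw [Finset.prod_mul_distrib, ← Real.exp_sum,
        Finset.prod_ite_eq' Finset.univ x fun z => if b = h z then (1 : ℝ) else 0]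
      simp
    simp only [this, Finset.sum_ite_eq', Finset.mem_univ, if_true]
  have h2 : ∀ b z, ∑ c, g b z c ≤ M * Real.exp (v z ^ 2 / M) *
      (if z = x then Real.exp (v z * (1 - 1 / M)) / M else 1) := by
    intro b z
    by_cases hz : z = x
    · simp only [hg, hz, if_true, ite_mul, one_mul, zero_mul, Finset.sum_ite_eq, Finset.mem_univ]
      have : 1 ≤ Real.exp (v x ^ 2 / M) := Real.one_le_exp (by positivity)
      calc _ = 1 * Real.exp (v x * (1 - 1 / M)) := by ring
        _ ≤ Real.exp (v x ^ 2 / M) * Real.exp (v x * (1 - 1 / M)) := by gcongr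
        _ = _ := by field_simp
    · simp only [hg, hz, if_false, one_mul, mul_one]
      exact sum_exp_indicator_le hM b (hv z)
  have h3 : ∀ b, ∏ z, ∑ c, g b z c ≤ (M : ℝ) ^ k * Real.exp (∑ z, v z ^ 2 / M) *
      (Real.exp (v x * (1 - 1 / M)) / M) := by
    intro b
    refine (Finset.prod_le_prod (fun z _ => Finset.sum_nonneg fun c _ => ?_)
      fun z _ => h2 b z).trans (le_of_eq ?_)
    · simp only [hg]
      split_ifs <;> positivity
    · rw [Finset.prod_mul_distrib, Finset.prod_mul_distrib, ← Real.exp_sum,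
        Finset.prod_ite_eq' Finset.univ x fun z => Real.exp (v z * (1 - 1 / M)) / M]
      simp
  simp only [h1]
  rw [Finset.sum_comm]
  calc _ = ∑ b, ∏ z, ∑ c, g b z c := Finset.sum_congr rfl fun b _ => sum_prod_eq_prod_sum _
    _ ≤ ∑ _b : Fin M, (M : ℝ) ^ k * Real.exp (∑ z, v z ^ 2 / M) *
      (Real.exp (v x * (1 - 1 / M)) / M) := Finset.sum_le_sum fun b _ => h3 b
    _ = _ := by
      simp only [Finset.sum_const, Finset.card_univ, Fintype.card_fin, nsmul_eq_mul]
      field_simp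

/-- The number of elements of `[k]`, weighted by `a`, that collide with the message `y`. -/
def collisions {k M : ℕ} {Y : Type} [DecidableEq Y] (e : Fin M ↪ Y) (a : Fin k → ℝ)
    (h : Fin k → Fin M) (y : Y) : ℝ :=
  ∑ x, a x * if y = e (h x) then 1 else 0

/-- The expectation of `collisions` for a random hash function and a sample from `p`. -/
def meanCollisions {k : ℕ} (M : ℕ) (a : Fin k → ℝ) (p : stdSimplex ℝ (Fin k)) : ℝ :=
  ∑ x, a x * (1 / M + (1 - 1 / M) * p.1 x)

/-- Two sources of fluctuation add in the exponent: the random hash contributes `A/M`, and the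
sample contributes `4` through the bounded variable `a x` centred at its `p`-mean `B`. -/
theorem sum_exp_collisions_sub_mean_le {k M : ℕ} (hM : 1 ≤ M) {Y : Type} [Fintype Y]
    [DecidableEq Y] (e : Fin M ↪ Y) (a : Fin k → ℝ) (ha : ∀ x, |a x| ≤ 1) {A t : ℝ}
    (hA : ∑ x, a x ^ 2 ≤ A) (ht0 : 0 ≤ t) (ht : t ≤ 1 / 2) (p : stdSimplex ℝ (Fin k)) :
    ∑ h : Fin k → Fin M, ∑ y, (hashChannel e h).output p y *
      Real.exp (t * (collisions e a h y - meanCollisions M a p)) ≤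
      (M : ℝ) ^ k * Real.exp (t ^ 2 * (A / M + 4)) := by
  have hM0 : (0 : ℝ) < M := by positivity
  have hM1 : (1 : ℝ) ≤ M := by exact_mod_cast hM
  have h1M : 1 / (M : ℝ) ≤ 1 := by rw [div_le_one hM0]; exact hM1
  have h0M : 0 < 1 / (M : ℝ) := by positivity
  obtain ⟨B, hB⟩ : ∃ B, B = ∑ x, p.1 x * a x := ⟨_, rfl⟩
  set w : Fin k → ℝ := fun x => t * (1 - 1 / M) * (a x - B) with hw
  have hB1 : |B| ≤ 1 := by
    calc |B| ≤ ∑ x, |p.1 x * a x| := hB ▸ Finset.abs_sum_le_sum_abs _ _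
      _ ≤ ∑ x, p.1 x := by
        refine Finset.sum_le_sum fun x _ => ?_
        rw [abs_mul, abs_of_nonneg (p.2.1 x)]
        exact mul_le_of_le_one_right (p.2.1 x) (ha x)
      _ = 1 := p.2.2
  have hw2 : ∀ x, |w x| ≤ 2 * t := by
    intro x
    have h1 : |a x - B| ≤ 2 := (abs_sub _ _).trans (by linarith [ha x])
    rw [hw, abs_mul, abs_mul, abs_of_nonneg ht0, abs_of_nonneg (by linarith : 0 ≤ 1 - 1 / (M : ℝ))]
    calc t * (1 - 1 / M) * |a x - B| ≤ t * 1 * 2 := by gcongr; linarith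
      _ = 2 * t := by ring
  have hexp : ∀ (h : Fin k → Fin M) x,
      Real.exp (t * (collisions e a h (e (h x)) - meanCollisions M a p)) =
        Real.exp (∑ z, t * a z * ((if h x = h z then 1 else 0) - 1 / M)) *
          Real.exp (-(t * (1 - 1 / M) * B)) := by
    intro h x
    rw [← Real.exp_add]
    congr 1
    simp only [collisions, meanCollisions, hB, e.injective.eq_iff, ← Finset.sum_sub_distrib,
      Finset.mul_sum]
    rw [← sub_eq_add_neg, ← Finset.sum_sub_distrib]
    refine Finset.sum_congr rfl fun z _ => ?_
    ring
  have hsq : ∑ z, (t * a z) ^ 2 / M ≤ t ^ 2 * (A / M) := by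
    simp only [mul_pow, ← Finset.sum_div, ← Finset.mul_sum]
    rw [mul_div_assoc]
    gcongr
  calc _ = ∑ x, p.1 x * (∑ h : Fin k → Fin M,
          Real.exp (∑ z, t * a z * ((if h x = h z then 1 else 0) - 1 / M))) *
            Real.exp (-(t * (1 - 1 / M) * B)) := by
        simp only [sum_output_hashChannel_mul, hexp]
        rw [Finset.sum_comm]
        refine Finset.sum_congr rfl fun x _ => ?_
        rw [Finset.mul_sum, Finset.sum_mul]
        exact Finset.sum_congr rfl fun h _ => (mul_assoc _ _ _).symm
    _ ≤ ∑ x, p.1 x * ((M : ℝ) ^ k * (Real.exp (t ^ 2 * (A / M)) *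
          Real.exp (t * a x * (1 - 1 / M)))) * Real.exp (-(t * (1 - 1 / M) * B)) := by
        refine Finset.sum_le_sum fun x _ => ?_
        refine mul_le_mul_of_nonneg_right (mul_le_mul_of_nonneg_left ?_ (p.2.1 x))
          (Real.exp_pos _).le
        refine (sum_exp_collisions_le hM (fun z => t * a z) (fun z => ?_) x).trans ?_
        · rw [abs_mul, abs_of_nonneg ht0]
          exact mul_le_one₀ (by linarith) (abs_nonneg _) (ha z)
        · gcongr
    _ = (M : ℝ) ^ k * Real.exp (t ^ 2 * (A / M)) * ∑ x, p.1 x * Real.exp (w x) := by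
        rw [Finset.mul_sum]
        refine Finset.sum_congr rfl fun x _ => ?_
        have : Real.exp (w x) = Real.exp (t * a x * (1 - 1 / M)) *
            Real.exp (-(t * (1 - 1 / M) * B)) := by
          rw [← Real.exp_add]
          congr 1
          simp only [hw]
          ring
        rw [this]
        ring
    _ ≤ (M : ℝ) ^ k * Real.exp (t ^ 2 * (A / M)) * (1 + 4 * t ^ 2) := by
        gcongr
        calc _ ≤ ∑ x, p.1 x * (1 + w x + 4 * t ^ 2) := by
              refine Finset.sum_le_sum fun x _ => mul_le_mul_of_nonneg_left ?_ (p.2.1 x)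
              have h1 := exp_le_one_add_add_sq ((hw2 x).trans (by linarith))
              have h2 : w x ^ 2 ≤ (2 * t) ^ 2 := sq_le_sq' (abs_le.1 (hw2 x)).1 (abs_le.1 (hw2 x)).2
              linarith
          _ = _ := by
              have h0 : ∑ x, p.1 x * w x = 0 := by
                have : ∀ x, p.1 x * w x = t * (1 - 1 / M) * (p.1 x * a x - p.1 x * B) := by
                  intro x; simp only [hw]; ring
                simp only [this, ← Finset.mul_sum, Finset.sum_sub_distrib, ← Finset.sum_mul]
                rw [p.2.2, ← hB]
                ring
              simp only [mul_add, Finset.sum_add_distrib, h0, ← Finset.sum_mul]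
              rw [p.2.2]
              ring
    _ ≤ (M : ℝ) ^ k * Real.exp (t ^ 2 * (A / M)) * Real.exp (4 * t ^ 2) := by
        gcongr
        linarith [Real.add_one_le_exp (4 * t ^ 2)]
    _ = _ := by
        rw [mul_assoc, ← Real.exp_add]
        ring_nf

theorem sum_exp_sum_collisions_le {k M n : ℕ} (hM : 1 ≤ M) {Y : Type} [Fintype Y]
    [DecidableEq Y] (e : Fin M ↪ Y) (a : Fin k → ℝ) (ha : ∀ x, |a x| ≤ 1) {A t : ℝ}
    (hA : ∑ x, a x ^ 2 ≤ A) (ht0 : 0 ≤ t) (ht : t ≤ 1 / 2) (p : stdSimplex ℝ (Fin k)) :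
    ∑ u : Fin n → Fin k → Fin M, ∑ y : Fin n → Y, (∏ i, (hashChannel e (u i)).output p (y i)) *
      Real.exp (t * ∑ i, (collisions e a (u i) (y i) - meanCollisions M a p)) ≤
      ((M : ℝ) ^ k) ^ n * Real.exp (n * (t ^ 2 * (A / M + 4))) := by
  simp only [Finset.mul_sum, Real.exp_sum, ← Finset.prod_mul_distrib]
  rw [Finset.sum_congr rfl fun u _ => sum_prod_eq_prod_sum fun i y =>
    (hashChannel e (u i)).output p y *
      Real.exp (t * (collisions e a (u i) y - meanCollisions M a p)),
    sum_prod_eq_prod_sum fun (_ : Fin n) h => ∑ y, (hashChannel e h).output p y *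
      Real.exp (t * (collisions e a h y - meanCollisions M a p))]
  rw [Finset.prod_const, Finset.card_univ, Fintype.card_fin, Real.exp_nat_mul, ← mul_pow]
  refine pow_le_pow_left₀ ?_ (sum_exp_collisions_sub_mean_le hM e a ha hA ht0 ht p) n
  exact Finset.sum_nonneg fun h _ => Finset.sum_nonneg fun y _ =>
    mul_nonneg (Channel.output_nonneg _ _ _) (Real.exp_pos _).le

/-! ### Sparse sign vectors and decoding -/

/-- The sign vectors with at most `r` nonzero entries. -/
def sparseSigns (k r : ℕ) : Finset (Fin k → SignType) :=
  Finset.univ.filter fun a => (Finset.univ.filter fun x => a x ≠ 0).card ≤ r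

/-- Weight each vector by `z` to the size of its support: the weights sum to `(1 + 2z)^k`. The later
choice `z = s/k` balances the two factors. -/
theorem card_sparseSigns_le (k r : ℕ) {z : ℝ} (hz0 : 0 < z) (hz : z ≤ 1) :
    ((sparseSigns k r).card : ℝ) ≤ z⁻¹ ^ r * Real.exp (k * (2 * z)) := by
  have hpt : ∀ a : Fin k → SignType,
      (if (Finset.univ.filter fun x => a x ≠ 0).card ≤ r then (1 : ℝ) else 0) ≤
      z⁻¹ ^ r * ∏ x, (if a x = 0 then 1 else z) := by
    intro a
    rw [Finset.prod_ite, Finset.prod_const_one, one_mul, Finset.prod_const]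
    split_ifs with h
    · rw [inv_pow, ← div_eq_inv_mul, one_le_div (by positivity)]
      exact pow_le_pow_of_le_one hz0.le hz h
    · positivity
  rw [sparseSigns, ← Finset.sum_boole]
  refine (Finset.sum_le_sum fun a _ => hpt a).trans ?_
  rw [← Finset.mul_sum,
    sum_prod_eq_prod_sum fun (_ : Fin k) (c : SignType) => if c = 0 then (1 : ℝ) else z]
  gcongr
  have : ∑ c : SignType, (if c = 0 then (1 : ℝ) else z) = 2 * z + 1 := by
    have : (Finset.univ : Finset SignType) = {0, -1, 1} := rfl
    rw [this]
    simp
    ring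
  rw [this, Finset.prod_const, Finset.card_univ, Fintype.card_fin, Real.exp_nat_mul]
  gcongr
  exact Real.add_one_le_exp _

theorem abs_signType_cast_le (c : SignType) : |(c : ℝ)| ≤ 1 := by
  cases c <;> simp

theorem sum_sq_le_of_mem_sparseSigns {k r : ℕ} {a : Fin k → SignType} (ha : a ∈ sparseSigns k r) :
    ∑ x, (a x : ℝ) ^ 2 ≤ r := by
  have h : ∀ x, (a x : ℝ) ^ 2 = if a x ≠ 0 then 1 else 0 := by
    intro x
    generalize a x = c
    cases c <;> simp
  simp only [h, Finset.sum_boole]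
  simp only [sparseSigns, Finset.mem_filter, Finset.mem_univ, true_and] at ha
  exact_mod_cast ha

theorem neg_mem_sparseSigns {k r : ℕ} {a : Fin k → SignType} (ha : a ∈ sparseSigns k r) :
    -a ∈ sparseSigns k r := by
  have h : ∀ c : SignType, -c ≠ 0 ↔ c ≠ 0 := by decide
  simp only [sparseSigns, Finset.mem_filter, Finset.mem_univ, true_and, Pi.neg_apply, h] at ha ⊢
  exact ha

theorem sign_sub_mem_sparseSigns {k s : ℕ} {p q : stdSimplex ℝ (Fin k)}
    (hp : p ∈ sparseDistributions k s) (hq : q ∈ sparseDistributions k s) :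
    (fun x => SignType.sign (p.1 x - q.1 x)) ∈ sparseSigns k (2 * s) := by
  simp only [sparseSigns, Finset.mem_filter, Finset.mem_univ, true_and]
  have h1 : ((Finset.univ.filter fun x => SignType.sign (p.1 x - q.1 x) ≠ 0 : Finset (Fin k)) :
      Set (Fin k)) ⊆ {x | p.1 x ≠ 0} ∪ {x | q.1 x ≠ 0} := by
    intro x hx
    by_contra h
    simp only [Set.mem_union, Set.mem_ofPred_eq, not_or, not_not] at h
    simp [h.1, h.2] at hx
  have h2 := (Set.ncard_le_ncard h1 (Set.toFinite _)).trans (Set.ncard_union_le _ _)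
  rw [Set.ncard_coe_finset] at h2
  have hp' : {x | p.1 x ≠ 0}.ncard ≤ s := hp
  have hq' : {x | q.1 x ≠ 0}.ncard ≤ s := hq
  omega

/-- All sparse statistics of the messages are close to their means under `p`. -/
def Consistent {k M n : ℕ} {Y : Type} [DecidableEq Y] (e : Fin M ↪ Y) (s : ℕ) (α : ℝ)
    (u : Fin n → Fin k → Fin M) (y : Fin n → Y) (p : stdSimplex ℝ (Fin k)) : Prop :=
  ∀ a ∈ sparseSigns k (2 * s),
    ∑ i, (collisions e (fun x => (a x : ℝ)) (u i) (y i) -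
      meanCollisions M (fun x => (a x : ℝ)) p) ≤ n * (α / 2)

/-- The sign of `p - q` turns the difference of means into `(1 - 1/M)` times the ℓ¹ distance, with
`1 - 1/M ≥ 1/2`. One-sided consistency suffices, because the sign vectors are closed under negation:
the vector is used for `q` and its negative for `p`. -/
theorem Consistent.tvDist_le {k M n s : ℕ} {Y : Type} [DecidableEq Y] {e : Fin M ↪ Y}
    {α : ℝ} {u : Fin n → Fin k → Fin M} {y : Fin n → Y} {p q : stdSimplex ℝ (Fin k)} (hn : 1 ≤ n)
    (hM : 2 ≤ M) (hp : p ∈ sparseDistributions k s) (hq : q ∈ sparseDistributions k s)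
    (hcp : Consistent e s α u y p) (hcq : Consistent e s α u y q) : tvDist p q ≤ α := by
  have hn0 : (0 : ℝ) < n := by positivity
  have hM2 : (2 : ℝ) ≤ M := by exact_mod_cast hM
  set a : Fin k → SignType := fun x => SignType.sign (p.1 x - q.1 x) with ha
  have hmem : a ∈ sparseSigns k (2 * s) := sign_sub_mem_sparseSigns hp hq
  have h1 := hcq a hmem
  have h2 := hcp (-a) (neg_mem_sparseSigns hmem)
  have h3 : ∀ i, collisions e (fun x => (((-a) x : SignType) : ℝ)) (u i) (y i) =
      - collisions e (fun x => (a x : ℝ)) (u i) (y i) := by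
    intro i
    simp only [collisions, Pi.neg_apply, SignType.coe_neg, neg_mul, Finset.sum_neg_distrib]
  have h4 : meanCollisions M (fun x => (((-a) x : SignType) : ℝ)) p =
      - meanCollisions M (fun x => (a x : ℝ)) p := by
    simp [meanCollisions]
  have h5 : meanCollisions M (fun x => (a x : ℝ)) p - meanCollisions M (fun x => (a x : ℝ)) q =
      (1 - 1 / M) * ∑ x, |p.1 x - q.1 x| := by
    simp only [meanCollisions]
    rw [← Finset.sum_sub_distrib, Finset.mul_sum]
    refine Finset.sum_congr rfl fun x _ => ?_
    rw [← sign_mul_self]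
    simp only [ha]
    ring
  simp only [h3, h4, Finset.sum_sub_distrib, Finset.sum_neg_distrib, Finset.sum_const,
    Finset.card_univ, Fintype.card_fin, nsmul_eq_mul] at h1 h2
  have h6 : (n : ℝ) * ((1 - 1 / M) * ∑ x, |p.1 x - q.1 x|) ≤ n * α := by
    rw [← h5]
    linarith
  have h7 := le_of_mul_le_mul_left h6 hn0
  have h8 : 1 / (M : ℝ) ≤ 1 / 2 := by gcongr
  have h9 : 0 ≤ ∑ x, |p.1 x - q.1 x| := Finset.sum_nonneg fun x _ => abs_nonneg _
  have h10 : 1 / 2 * ∑ x, |p.1 x - q.1 x| ≤ (1 - 1 / M) * ∑ x, |p.1 x - q.1 x| := by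
    gcongr
    linarith
  exact h10.trans h7

open Classical in
/-- An estimator that returns a sparse distribution consistent with the messages, if any. -/
def consistentEstimator {k M n : ℕ} {Y : Type} [DecidableEq Y] (e : Fin M ↪ Y) (s : ℕ) (α : ℝ)
    (p₀ : stdSimplex ℝ (Fin k)) (u : Fin n → Fin k → Fin M) (y : Fin n → Y) :
    stdSimplex ℝ (Fin k) :=
  if h : ∃ p ∈ sparseDistributions k s, Consistent e s α u y p then h.choose else p₀

/-! ### Union bound and choice of parameters -/

theorem exists_protocol_of_hash {k s ℓ M n : ℕ} (hk : 1 ≤ k) (hM : 2 ≤ M) (hMℓ : M ≤ 2 ^ ℓ)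
    (hn : 1 ≤ n) {α t : ℝ} (ht0 : 0 ≤ t) (ht : t ≤ 1 / 2)
    (hsmall : ((sparseSigns k (2 * s)).card : ℝ) *
      Real.exp (n * (t ^ 2 * (2 * s / M + 4)) - t * (n * (α / 2))) ≤ 1 / 10) :
    ∃ P : PublicCoinProtocol k n (Fin ℓ → Bool) (bitChannels k ℓ),
      ∀ p ∈ sparseDistributions k s, (9 / 10 : ℝ) ≤ P.successProb tvDist α p := by
  classical
  obtain ⟨e⟩ : Nonempty (Fin M ↪ (Fin ℓ → Bool)) := by
    rw [Function.Embedding.nonempty_iff_card_le]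
    simpa using hMℓ
  have : NeZero M := ⟨by omega⟩
  have p₀ : stdSimplex ℝ (Fin k) := ⟨_, single_mem_stdSimplex ℝ (⟨0, hk⟩ : Fin k)⟩
  have hW : ∀ (u : Fin n → Fin k → Fin M) (i : Fin n), hashChannel e (u i) ∈ bitChannels k ℓ :=
    fun _ _ => Set.mem_univ _
  refine ⟨uniformProtocol (Fin n → Fin k → Fin M) (fun u i => hashChannel e (u i)) hW
    (consistentEstimator e s α p₀), fun p hp => ?_⟩
  rw [successProb_uniformProtocol]
  set N : ℝ := ((M : ℝ) ^ k) ^ n with hN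
  have hN0 : 0 < N := by positivity
  have hcard : (Fintype.card (Fin n → Fin k → Fin M) : ℝ) = N := by simp [hN]
  set S : (Fin k → SignType) → (Fin n → Fin k → Fin M) → (Fin n → Fin ℓ → Bool) → ℝ :=
    fun a u y => ∑ i, (collisions e (fun x => (a x : ℝ)) (u i) (y i) -
      meanCollisions M (fun x => (a x : ℝ)) p) with hS
  -- Pointwise Chernoff and union bound: failure forces some sign vector to violate consistency for
  -- the true `p`, and its exponential term is then at least `1`.
  have hind : ∀ u y, 1 - ∑ a ∈ sparseSigns k (2 * s),
      Real.exp (t * S a u y) * Real.exp (- (t * (n * (α / 2)))) ≤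
      if tvDist p (consistentEstimator e s α p₀ u y) ≤ α then 1 else 0 := by
    intro u y
    by_cases hc : Consistent e s α u y p
    · have hex : ∃ p ∈ sparseDistributions k s, Consistent e s α u y p := ⟨p, hp, hc⟩
      have hd : tvDist p (consistentEstimator e s α p₀ u y) ≤ α := by
        rw [consistentEstimator, dif_pos hex]
        exact Consistent.tvDist_le hn hM hp hex.choose_spec.1 hc hex.choose_spec.2
      rw [if_pos hd, sub_le_self_iff]
      exact Finset.sum_nonneg fun a _ => by positivity
    · simp only [Consistent, not_forall, not_le] at hc
      obtain ⟨a, ha, hlt⟩ := hc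
      have h1 : 1 ≤ Real.exp (t * S a u y) * Real.exp (- (t * (n * (α / 2)))) := by
        rw [← Real.exp_add]
        apply Real.one_le_exp
        have := mul_le_mul_of_nonneg_left hlt.le ht0
        linarith
      have h2 := Finset.single_le_sum (f := fun a =>
        Real.exp (t * S a u y) * Real.exp (- (t * (n * (α / 2)))))
        (fun a _ => by positivity) ha
      have h3 : (0 : ℝ) ≤ if tvDist p (consistentEstimator e s α p₀ u y) ≤ α then 1 else 0 := by
        split_ifs <;> norm_num
      linarith
  have hprob : ∀ u : Fin n → Fin k → Fin M,
      ∑ y : Fin n → Fin ℓ → Bool, ∏ i, (hashChannel e (u i)).output p (y i) = 1 := by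
    intro u
    rw [sum_prod_eq_prod_sum fun i => (hashChannel e (u i)).output p]
    simp [Channel.sum_output]
  rw [hcard, ← div_eq_inv_mul, le_div_iff₀ hN0]
  calc 9 / 10 * N ≤ N - N * (((sparseSigns k (2 * s)).card : ℝ) *
        Real.exp (n * (t ^ 2 * (2 * s / M + 4)) - t * (n * (α / 2)))) := by
        linarith [mul_le_mul_of_nonneg_left hsmall hN0.le]
    _ = N - ∑ a ∈ sparseSigns k (2 * s), N * Real.exp (n * (t ^ 2 * (2 * s / M + 4))) *
        Real.exp (- (t * (n * (α / 2)))) := by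
        rw [Finset.sum_const, nsmul_eq_mul, mul_assoc N, ← Real.exp_add, ← sub_eq_add_neg]
        ring
    _ ≤ N - ∑ a ∈ sparseSigns k (2 * s), (∑ u, ∑ y : Fin n → Fin ℓ → Bool,
        (∏ i, (hashChannel e (u i)).output p (y i)) * Real.exp (t * S a u y)) *
        Real.exp (- (t * (n * (α / 2)))) := by
        gcongr with a ha
        exact sum_exp_sum_collisions_le (by omega) e (fun x => (a x : ℝ))
          (fun x => abs_signType_cast_le _)
          ((sum_sq_le_of_mem_sparseSigns ha).trans (le_of_eq (by push_cast; rfl))) ht0 ht p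
    _ = ∑ u, ∑ y : Fin n → Fin ℓ → Bool, (∏ i, (hashChannel e (u i)).output p (y i)) *
        (1 - ∑ a ∈ sparseSigns k (2 * s),
          Real.exp (t * S a u y) * Real.exp (- (t * (n * (α / 2))))) := by
        simp only [mul_sub, mul_one, Finset.sum_sub_distrib, hprob, Finset.mul_sum, Finset.sum_mul]
        congr 1
        · simp [hN]
        · rw [Finset.sum_comm]
          refine Finset.sum_congr rfl fun u _ => ?_
          rw [Finset.sum_comm]
          refine Finset.sum_congr rfl fun y _ => Finset.sum_congr rfl fun a _ => ?_
          ring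
    _ ≤ _ := by
        refine Finset.sum_le_sum fun u _ => Finset.sum_le_sum fun y _ => ?_
        exact mul_le_mul_of_nonneg_left (hind u y)
          (Finset.prod_nonneg fun i _ => Channel.output_nonneg _ _ _)

theorem exists_protocol_le {k s ℓ : ℕ} {α : ℝ} (hs : 1 ≤ s) (hk : 100 * s ≤ k) (hℓ : 1 ≤ ℓ)
    (hα0 : 0 < α) (hα : α < 1) :
    ∃ (n : ℕ) (P : PublicCoinProtocol k n (Fin ℓ → Bool) (bitChannels k ℓ)),
      (∀ p ∈ sparseDistributions k s, (9 / 10 : ℝ) ≤ P.successProb tvDist α p) ∧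
      (n : ℝ) ≤ 2240 * ((s : ℝ) ^ 2 * max (Real.log ((k : ℝ) / s)) 1 /
        (α ^ 2 * min ((2 : ℝ) ^ ℓ) s)) := by
  have hs1 : (1 : ℝ) ≤ s := by exact_mod_cast hs
  have hs0 : (0 : ℝ) < s := by linarith
  have hks : (100 : ℝ) * s ≤ k := by exact_mod_cast hk
  have hk0 : (0 : ℝ) < k := by linarith
  have hL : 1 ≤ Real.log ((k : ℝ) / s) := by
    rw [Real.le_log_iff_exp_le (by positivity), le_div_iff₀ hs0]
    nlinarith [Real.exp_one_lt_d9]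
  rw [max_eq_left hL]
  obtain ⟨L, hLdef⟩ : ∃ L, L = Real.log ((k : ℝ) / s) := ⟨_, rfl⟩
  rw [← hLdef] at hL ⊢
  have h2ℓ : 2 ≤ 2 ^ ℓ := by simpa using Nat.pow_le_pow_right (n := 2) (by norm_num) hℓ
  -- More than about `s` buckets would not help, since the sampling term `4` then dominates `2s/M`.
  -- The `max` with `2` matters for `s = 1`, where a single bucket carries no information.
  obtain ⟨M, hM⟩ : ∃ M, M = min (2 ^ ℓ) (max s 2) := ⟨_, rfl⟩
  have hM2 : 2 ≤ M := by rw [hM]; exact le_min h2ℓ (le_max_right _ _)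
  have hMs : (M : ℝ) ≤ 2 * s := by
    have : M ≤ 2 * s := by rw [hM]; exact (min_le_right _ _).trans (by omega)
    exact_mod_cast this
  have hM0 : (0 : ℝ) < M := by positivity
  obtain ⟨m, hm⟩ : ∃ m, m = min ((2 : ℝ) ^ ℓ) s := ⟨_, rfl⟩
  rw [← hm]
  have hm0 : 0 < m := by rw [hm]; exact lt_min (by positivity) hs0
  have hms : m ≤ s := by rw [hm]; exact min_le_right _ _
  have hmM : m ≤ M := by
    rw [hm, hM]
    push_cast
    exact min_le_min_left _ (le_max_left _ _)
  have hα2 : α ^ 2 ≤ 1 := by nlinarith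
  set R := (s : ℝ) ^ 2 * L / (α ^ 2 * m) with hR
  have hR1 : 1 ≤ R := by
    rw [hR, one_le_div (by positivity)]
    calc α ^ 2 * m ≤ 1 * s := by gcongr
      _ ≤ (s : ℝ) ^ 2 * 1 := by nlinarith
      _ ≤ _ := by gcongr
  obtain ⟨n, hn⟩ : ∃ n, n = ⌈1120 * R⌉₊ := ⟨_, rfl⟩
  have hn1 : 1120 * R ≤ n := by rw [hn]; exact Nat.le_ceil _
  have hn2 : (n : ℝ) ≤ 2240 * R := by
    have := Nat.ceil_lt_add_one (show 0 ≤ 1120 * R by positivity)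
    rw [← hn] at this
    linarith
  have hn0 : 1 ≤ n := by
    have : (1 : ℝ) ≤ n := by linarith
    exact_mod_cast this
  have hexp : 7 * (s * L) ≤ n * α ^ 2 * M / (160 * s) := by
    rw [le_div_iff₀ (by positivity)]
    calc 7 * (s * L) * (160 * s) = 1120 * R * α ^ 2 * m := by
          rw [hR]; field_simp; ring
      _ ≤ n * α ^ 2 * M := by gcongr
  -- Since `2s/M + 4 ≤ 10s/M`, the exponent per user is at most `10 t² s/M - tα/2`, minimised at
  -- this `t` with value `-α²M/(160s)`. The constant `1120 = 7 · 160` makes the total at most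
  -- `-7sL`, against `2sL + 2s` from the union bound; what remains is at most `-3`.
  obtain ⟨P, hP⟩ := exists_protocol_of_hash (k := k) (s := s) (ℓ := ℓ) (M := M) (n := n)
    (α := α) (t := α * M / (40 * s)) (by omega) hM2 (by rw [hM]; exact min_le_left _ _) hn0
    (by positivity) (by
      rw [div_le_iff₀ (by positivity)]
      nlinarith) (by
      have hz : (s : ℝ) / k ≤ 1 := by rw [div_le_one hk0]; linarith
      have hcard := card_sparseSigns_le k (2 * s) (z := s / k) (by positivity) hz
      have h1 : ((s : ℝ) / k)⁻¹ ^ (2 * s) * Real.exp (k * (2 * (s / k))) =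
          Real.exp (2 * s * L + 2 * s) := by
        rw [Real.exp_add, inv_div, hLdef]
        congr 1
        · rw [← Real.exp_log (show 0 < (k : ℝ) / s by positivity), ← Real.exp_nat_mul,
            Real.log_exp]
          push_cast
          rfl
        · congr 1
          field_simp
      rw [h1] at hcard
      have h2 : n * ((α * M / (40 * s)) ^ 2 * (2 * s / M + 4)) - α * M / (40 * s) * (n * (α / 2)) ≤
          - (n * α ^ 2 * M / (160 * s)) := by
        have h3 : 2 * (s : ℝ) / M + 4 ≤ 10 * s / M := by
          rw [div_add' _ _ _ hM0.ne']
          gcongr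
          linarith
        calc _ ≤ n * ((α * M / (40 * s)) ^ 2 * (10 * s / M)) -
              α * M / (40 * s) * (n * (α / 2)) := by gcongr
          _ = _ := by field_simp; ring
      have hsL : 1 ≤ s * L := by nlinarith
      calc _ ≤ Real.exp (2 * s * L + 2 * s) * Real.exp (-(7 * (s * L))) := by
            gcongr
            linarith
        _ = Real.exp (2 * s * L + 2 * s - 7 * (s * L)) := by
            rw [← Real.exp_add, ← sub_eq_add_neg]
        _ ≤ Real.exp (-(3 : ℕ)) := by
            gcongr
            push_cast
            nlinarith
        _ ≤ 1 / 10 := by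
            rw [Real.exp_neg, ← mul_one ((3 : ℕ) : ℝ), Real.exp_nat_mul, one_div]
            gcongr
            calc (10 : ℝ) ≤ 2.7 ^ 3 := by norm_num
              _ ≤ _ := by
                gcongr
                linarith [Real.exp_one_gt_d9])
  exact ⟨n, P, hP, hn2⟩

end

theorem theorem2 :
    (∃ C : ℝ, 0 < C ∧ ∀ (k s ℓ : ℕ) (α : ℝ),
      1 ≤ s → 100 * s ≤ k → 1 ≤ ℓ → 0 < α → α < 1 →
        (sampleComplexity α (sparseDistributions k s) (bitChannels k ℓ) tvDist : ENNReal) ≤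
          ENNReal.ofReal (C * ((s : ℝ) ^ 2 * max (Real.log ((k : ℝ) / s)) 1 /
            (α ^ 2 * min ((2 : ℝ) ^ ℓ) s)))) ∧
    (∃ c : ℝ, 0 < c ∧ ∀ (k s ℓ : ℕ) (α : ℝ),
      2 ≤ s → 100 * s ≤ k → 1 ≤ ℓ → 0 < α → α ≤ 1 / 8 →
        ENNReal.ofReal (c * max ((s : ℝ) ^ 2 / (α ^ 2 * min ((2 : ℝ) ^ ℓ) s))
            ((s : ℝ) ^ 2 * max (Real.log ((k : ℝ) / s)) 1 / (α * (2 : ℝ) ^ ℓ))) ≤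
          (sampleComplexity α (sparseDistributions k s) (bitChannels k ℓ) tvDist : ENNReal)) := by
  refine ⟨⟨2240, by norm_num, fun k s ℓ α hs hk hℓ hα0 hα => ?_⟩,
    ⟨1 / 10000, by norm_num, fun k s ℓ α hs hk hℓ hα0 hα => ?_⟩⟩
  · obtain ⟨n, P, hP, hn⟩ := exists_protocol_le hs hk hℓ hα0 hα
    exact sampleComplexity_le_ofReal P hP hn
  · exact ofReal_le_sampleComplexity fun n P hP => sparse_lower_bound hs hk hα0 hα P hP
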